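/- Let $X=G/P$, where $G$ is a connected, simply connected, semisimple complex Lie group and $P$ is a parabolic subgroup, and fix a maximal torus $T$ and a Borel subgroup $B$ with $T\subset B\subset P$. Let $R$ be the root system, $R^+$ the positive roots, $\Delta$ the simple roots, $W$ the Weyl group, $W_P\subset W$ the Weyl group of $P$, $\Delta_P=\{\beta\in\Delta : s_\beta\in W_P\}$ and $R^+_P=R^+\cap\mathbb Z\Delta_P$. Order the roots by $\alpha\le\beta$ if $\beta-\alpha$ is a non-negative combination of simple roots. For $w\in W$ put $I(w)=\{\gamma\in R^+ : w(\gamma)<0\}$, and define the length of the coset $wW_P$ by $\ell(wW_P)=|I(w)\smallsetminus R^+_P|$. Identify $H_2(X)$ with $\mathbb Z\Delta^\vee/\mathbb Z\Delta_P^\vee$, partially ordered by $d\le e$ if $e-d$ is a combination, with non-negative integer coefficients, of the classes $\beta^\vee+\mathbb Z\Delta_P^\vee$, $\beta\in\Delta\smallsetminus\Delta_P$. Identify $H^2(X)$ with the group of integral weights vanishing on $\Delta_P^\vee$, so that the weight $\lambda$ corresponds to the first Chern class of the line bundle $G\times^P\mathbb C_{-\lambda}$. Let $(c_1(T_X),\alpha^\vee)$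 be the pairing of the first Chern class of the tangent bundle of $X$ with the class of $\alpha^\vee$. A root $\alpha\in R^+\smallsetminus R^+_P$ is called $P$-cosmall if it is a maximal element of the set $\{\gamma\in R^+\smallsetminus R^+_P : \gamma^\vee+\mathbb Z\Delta_P^\vee\le\alpha^\vee+\mathbb Z\Delta_P^\vee\}$. **Theorem.** For every root $\alpha\in R^+\smallsetminus R^+_P$ we have $\ell(s_\alpha W_P)\le (c_1(T_X),\alpha^\vee)-1$. Moreover, the following are equivalent. (a) The root $\alpha$ is $P$-cosmall. (b) We have equality $\ell(s_\alpha W_P)=(c_1(T_X),\alpha^\vee)-1$. (c) We have $(R^+\smallsetminus R^+_P)\cap s_\alpha(R^+_P)=\emptyset$, and $(\gamma,\alpha^\vee)=1$ for all $\gamma\in I(s_\alpha)\smallsetminus(R^+_P\cup\{\alpha\})$. -/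

import Mathlib

/-!
Combinatorics of a homogeneous space `X = G/P`: roots, inversion sets, lengths of cosets of the
Weyl group, `H₂(X)` and its order, cosmall roots, and the first Chern class of `X`.
-/

noncomputable section

namespace FlagVariety

open RootPairing

/-! ### Root-theoretic notions

Roots are indexed by `ι`, so that sets of roots are sets of indices. The base `b` is `Δ`, and the
set `J` of simple roots is `Δ_P`. -/

section RootTheory

variable {ι R M N : Type*} [CommRing R] [CharZero R] [AddCommGroup M] [Module R M]
  [AddCommGroup N] [Module R N] {P : RootPairing ι R M N} (b : P.Base) (J : Set b.support)

/-- The positive roots `R⁺`. -/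
def posRoots : Set ι := {i | b.IsPos i}

/-- The positive roots `R⁺_P = R⁺ ∩ ℤΔ_P` of `P`. -/
def posRootsP : Set ι :=
  {i | b.IsPos i ∧ P.root i ∈ AddSubgroup.closure ((fun j : b.support ↦ P.root j) '' J)}

/-- The partial order on roots: `α ≤ β` if `β - α` is a combination of simple roots with
non-negative coefficients. (These coefficients are automatically integers, because roots lie in
the lattice spanned by the simple roots.) -/
def RootLE (i j : ι) : Prop :=
  P.root j - P.root i ∈ AddSubmonoid.closure (P.root '' b.support)

/-- The coroot lattice `ℤΔ^∨`. -/
abbrev corootLattice : AddSubgroup N :=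
  AddSubgroup.closure (P.coroot '' b.support)

/-- The coroot lattice `ℤΔ_P^∨` of `P`. -/
abbrev corootLatticeP : AddSubgroup N :=
  AddSubgroup.closure ((fun j : b.support ↦ P.coroot j) '' J)

/-- The group `H₂(X) = ℤΔ^∨ / ℤΔ_P^∨`. -/
abbrev H2 : Type _ :=
  corootLattice b ⧸ (corootLatticeP b J).addSubgroupOf (corootLattice b)

theorem coroot_mem_corootLattice (i : ι) : P.coroot i ∈ corootLattice b := by
  have h := b.coroot_mem_span_int i
  rwa [← AddSubgroup.toIntSubmodule_closure] at h

/-- The class `α^∨ + ℤΔ_P^∨` in `H₂(X)`. -/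
def corootClass (i : ι) : H2 b J :=
  QuotientAddGroup.mk ⟨P.coroot i, coroot_mem_corootLattice b i⟩

/-- The partial order on `H₂(X)`: `d ≤ e` if `e - d` is effective, that is a combination with
non-negative integer coefficients of the classes `β^∨ + ℤΔ_P^∨` for `β ∈ Δ \ Δ_P`. -/
def DegreeLE (d e : H2 b J) : Prop :=
  e - d ∈ AddSubmonoid.closure ((fun j : b.support ↦ corootClass b J j) '' Jᶜ)

/-- The set of `α ∈ R⁺ \ R⁺_P` with `α^∨ + ℤΔ_P^∨ ≤ d`. -/
def rootsBelow (d : H2 b J) : Set ι :=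
  {i | i ∈ posRoots b \ posRootsP b J ∧ DegreeLE b J (corootClass b J i) d}

/-- `α` is a maximal root of the degree `d`. -/
def IsMaximalRoot (d : H2 b J) (i : ι) : Prop :=
  i ∈ rootsBelow b J d ∧ ∀ j ∈ rootsBelow b J d, RootLE b i j → j = i

/-- `α` is `P`-cosmall if it is a maximal root of `α^∨ + ℤΔ_P^∨`. -/
def IsCosmall (i : ι) : Prop := IsMaximalRoot b J (corootClass b J i) i

/-- The inversion set `I(w) = {α ∈ R⁺ | w(α) < 0}`. -/
def inversions (w : P.weylGroup) : Set ι :=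
  {i | b.IsPos i ∧ ¬ b.IsPos (P.weylGroupToPerm w i)}

/-- The Weyl group `W_P`, generated by the simple reflections `s_β` for `β ∈ Δ_P`. -/
def weylP : Subgroup P.weylGroup :=
  Subgroup.closure ((fun j : b.support ↦ weylGroup.ofIdx P j) '' J)

variable [Finite ι] [IsDomain R] [P.IsCrystallographic] [P.IsReduced]

theorem simpleReflection_mem {j : b.support} (hj : j ∈ J) {i : ι}
    (hi : i ∈ posRoots b \ posRootsP b J) :
    P.reflectionPerm j i ∈ posRoots b \ posRootsP b J := by
  have hjm : P.root j ∈ AddSubgroup.closure ((fun j : b.support ↦ P.root j) '' J) :=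
    AddSubgroup.subset_closure ⟨j, hj, rfl⟩
  have hij : i ≠ j := by
    rintro rfl
    exact hi.2 ⟨hi.1, hjm⟩
  refine ⟨Base.IsPos.reflectionPerm hi.1 j.2 hij, fun h ↦ hi.2 ⟨hi.1, ?_⟩⟩
  have h2 := h.2
  rw [root_reflectionPerm, reflection_apply_root' ℤ] at h2
  have := add_mem h2 (zsmul_mem hjm (P.pairingIn ℤ i j))
  simpa using this

theorem weylP_mem {v : P.weylGroup} (hv : v ∈ weylP b J) {i : ι}
    (hi : i ∈ posRoots b \ posRootsP b J) :
    P.weylGroupToPerm v i ∈ posRoots b \ posRootsP b J := by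
  induction hv using Subgroup.closure_induction'' generalizing i with
  | one => simpa using hi
  | mem x hx =>
    obtain ⟨j, hj, rfl⟩ := hx
    exact simpleReflection_mem b J hj hi
  | inv_mem x hx =>
    obtain ⟨j, hj, rfl⟩ := hx
    have : (weylGroup.ofIdx P (j : ι))⁻¹ = weylGroup.ofIdx P j :=
      Subtype.ext (Equiv.reflection_inv P j)
    rw [this]
    exact simpleReflection_mem b J hj hi
  | mul x y _ _ hx hy =>
    rw [map_mul]
    exact hx (hy hi)

/-- The number `|I(w) \ R⁺_P|` depends only on the coset `w W_P`. -/
theorem ncard_inversions_mul (w : P.weylGroup) {v : P.weylGroup} (hv : v ∈ weylP b J) :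
    (inversions b (w * v) \ posRootsP b J).ncard = (inversions b w \ posRootsP b J).ncard := by
  refine Set.ncard_congr (fun i _ ↦ P.weylGroupToPerm v i) ?_ ?_ ?_
  · rintro i ⟨⟨h1, h2⟩, h3⟩
    have := weylP_mem b J hv (i := i) ⟨h1, h3⟩
    refine ⟨⟨this.1, ?_⟩, this.2⟩
    rwa [map_mul] at h2
  · intro i j _ _ h
    exact (P.weylGroupToPerm v).injective h
  · rintro i ⟨⟨h1, h2⟩, h3⟩
    have := weylP_mem b J (inv_mem hv) (i := i) ⟨h1, h3⟩
    have hvi : P.weylGroupToPerm v (P.weylGroupToPerm v⁻¹ i) = i := by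
      rw [← Equiv.Perm.mul_apply, ← map_mul]
      simp
    refine ⟨_, ⟨⟨this.1, ?_⟩, this.2⟩, hvi⟩
    rw [map_mul, Equiv.Perm.mul_apply, hvi]
    exact h2

/-- The length `ℓ(w W_P) = |I(w) \ R⁺_P|` of a coset in `W/W_P`. -/
def cosetLength (c : P.weylGroup ⧸ weylP b J) : ℕ :=
  Quotient.liftOn' c (fun w ↦ (inversions b w \ posRootsP b J).ncard) fun w w' h ↦ by
    have := ncard_inversions_mul b J w (QuotientGroup.leftRel_apply.mp h)
    simpa using this.symm

end RootTheory

/-! ### Parabolic subalgebras and the first Chern class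

The simply connected semisimple group `G` with its subgroups `T ⊆ B ⊆ P` is given by its Lie
algebra `L`, the Cartan subalgebra `H`, the base `b` of the root system, and the Lie algebra
`p` of `P`. -/

section Lie

open LieAlgebra LieAlgebra.IsKilling

variable {L : Type*} [LieRing L] [LieAlgebra ℂ L] [FiniteDimensional ℂ L] [IsKilling ℂ L]
  {H : LieSubalgebra ℂ L} [H.IsCartanSubalgebra]

/-- The Borel subalgebra, generated by `H` and the root spaces of the positive roots. -/
def borel (b : (rootSystem H).Base) : LieSubalgebra ℂ L :=
  LieSubalgebra.lieSpan ℂ L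
    ((H : Set L) ∪ ⋃ i ∈ posRoots b, (rootSpace H (i : LieModule.Weight ℂ H L) : Set L))

theorem cartan_le_of_borel_le {b : (rootSystem H).Base} {p : LieSubalgebra ℂ L}
    (hp : borel b ≤ p) : H ≤ p :=
  fun _ hx ↦ hp (LieSubalgebra.subset_lieSpan (Or.inl hx))

/-- The set `Δ_P` of simple roots `β` of the Levi subgroup of `P`: those for which the root space
of `-β` lies in the Lie algebra of `P`, as the root space of `β` always does. -/
def simpleRootsP (b : (rootSystem H).Base) (p : LieSubalgebra ℂ L) : Set b.support :=
  {j | ∀ x ∈ rootSpace H (-((j : H.root) : LieModule.Weight ℂ H L) : H → ℂ), x ∈ p}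

/-- The first Chern class of the homogeneous vector bundle `G ×^P V` on `X`, under the
identification of `H²(X)` with a group of weights in `H^*` for which the line bundle
`L_λ = G ×^P ℂ_{-λ}` has first Chern class `λ`. The determinant of `V` is the character of `P`
whose derivative is the trace of `V`, so the weight is minus this trace. -/
def chernClass {p : LieSubalgebra ℂ L} (hH : H ≤ p) (V : Type*) [AddCommGroup V] [Module ℂ V]
    [LieRingModule p V] [LieModule ℂ p V] : Module.Dual ℂ H :=
  -(LinearMap.trace ℂ V ∘ₗ (LieModule.toEnd ℂ p V : p →ₗ[ℂ] Module.End ℂ V) ∘ₗ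
    (LieSubalgebra.inclusion hH : H →ₗ[ℂ] p))

/-- The class `c₁(T_X)`: the tangent bundle of `X = G/P` is the homogeneous vector bundle
`G ×^P (L/p)`, where `L/p` is the isotropy representation on the tangent space at `1.P`. -/
def chernClassTangent {p : LieSubalgebra ℂ L} (hH : H ≤ p) : Module.Dual ℂ H :=
  chernClass hH (L ⧸ p.toLieSubmodule)

end Lie

end FlagVariety

end

open FlagVariety LieAlgebra.IsKilling

/-! Write `S = R⁺ \ R⁺_P`. The proof reduces the theorem to two statements about roots.

The representation `L/p` has weights `-γ`, `γ ∈ S`, each of multiplicity one, so `c₁(T_X)` is the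
sum of `S` and its pairing with `α^∨` is `∑ (γ, α^∨)` over `S` (`chernClassTangent_apply`). Split
this sum by the position of `s_α γ`. Terms with `s_α γ ∈ S` cancel, because `s_α` permutes them and
reverses the sign of the pairing. Inverted roots pair positively, and `α` itself contributes 2.
Terms with `s_α γ ∈ R⁺_P` are positive. Hence the degree exceeds `ℓ(s_α W_P) + 1` by two
non-negative defects, which vanish exactly when (c) holds (`degree_eq`,
`cosetLength_reflection_le`).

For (a) ⇔ (c), the first half of (c) says that `α` pairs non-negatively with `R⁺_P`
(`isDominantP_iff`). If `α` violates either half, a reflection produces a root that contradicts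
maximality. Conversely, assume (c), `β ≥ α` and `β^∨ ≤ α^∨` modulo `ℤΔ_P^∨`. Comparing coordinates
outside `Δ_P` shows that `β` is at least as long as `α`. If the lengths agree, `β - α` is supported
on `Δ_P`, so dominance gives `(β, α^∨) ≥ 2` and `β = α`. If `β` is longer,
`exists_long_root_pairingIn_pos` supplies a long root at an acute angle to `α`, apart from `G₂`
configurations treated by hand, and `false_of_acute_long_root` refutes it. -/

noncomputable section

namespace FlagVariety

open RootPairing Set

/-! ### Integer coordinates for subgroups and submonoids generated by part of a finite family. -/

section Closure

variable {A κ : Type*} [AddCommGroup A] [Fintype κ]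

theorem mem_addSubgroupClosure_image_iff (v : κ → A) (J : Set κ) (x : A) :
    x ∈ AddSubgroup.closure (v '' J) ↔
      ∃ c : κ → ℤ, (∀ k ∉ J, c k = 0) ∧ x = ∑ k, c k • v k := by
  classical
  refine ⟨fun h ↦ ?_, ?_⟩
  · induction h using AddSubgroup.closure_induction with
    | mem x hx =>
      obtain ⟨k, hk, rfl⟩ := hx
      refine ⟨Pi.single k 1, fun l hl ↦ Pi.single_eq_of_ne (by rintro rfl; exact hl hk) _, ?_⟩
      simp [Pi.single_apply, ite_smul]
    | zero => exact ⟨0, by simp, by simp⟩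
    | add x y _ _ hx hy =>
      obtain ⟨c, hc, rfl⟩ := hx
      obtain ⟨d, hd, rfl⟩ := hy
      exact ⟨c + d, fun k hk ↦ by simp [hc k hk, hd k hk],
        by simp [add_smul, Finset.sum_add_distrib]⟩
    | neg x _ hx =>
      obtain ⟨c, hc, rfl⟩ := hx
      exact ⟨-c, fun k hk ↦ by simp [hc k hk], by simp⟩
  · rintro ⟨c, hc, rfl⟩
    refine sum_mem fun k _ ↦ ?_
    by_cases hk : k ∈ J
    · exact zsmul_mem (AddSubgroup.subset_closure (mem_image_of_mem v hk)) _
    · simp [hc k hk]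

theorem mem_addSubmonoidClosure_image_iff (v : κ → A) (J : Set κ) (x : A) :
    x ∈ AddSubmonoid.closure (v '' J) ↔
      ∃ c : κ → ℤ, 0 ≤ c ∧ (∀ k ∉ J, c k = 0) ∧ x = ∑ k, c k • v k := by
  classical
  refine ⟨fun h ↦ ?_, ?_⟩
  · induction h using AddSubmonoid.closure_induction with
    | mem x hx =>
      obtain ⟨k, hk, rfl⟩ := hx
      refine ⟨Pi.single k 1, Pi.single_nonneg.mpr zero_le_one,
        fun l hl ↦ Pi.single_eq_of_ne (by rintro rfl; exact hl hk) _, ?_⟩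
      simp [Pi.single_apply, ite_smul]
    | zero => exact ⟨0, le_rfl, by simp, by simp⟩
    | add x y _ _ hx hy =>
      obtain ⟨c, hc₀, hc, rfl⟩ := hx
      obtain ⟨d, hd₀, hd, rfl⟩ := hy
      exact ⟨c + d, add_nonneg hc₀ hd₀, fun k hk ↦ by simp [hc k hk, hd k hk],
        by simp [add_smul, Finset.sum_add_distrib]⟩
  · rintro ⟨c, hc₀, hc, rfl⟩
    refine sum_mem fun k _ ↦ ?_
    by_cases hk : k ∈ J
    · obtain ⟨n, hn⟩ := Int.eq_ofNat_of_zero_le (hc₀ k)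
      rw [hn, natCast_zsmul]
      exact nsmul_mem (AddSubmonoid.subset_closure (mem_image_of_mem v hk)) _
    · simp [hc k hk]

end Closure

/-! ### Positivity and the two partial orders in terms of simple coordinates. -/

section Coordinates

variable {ι R M N : Type*} [CommRing R] [CharZero R] [AddCommGroup M] [Module R M]
  [AddCommGroup N] [Module R N] {P : RootPairing ι R M N} (b : P.Base) (J : Set b.support)

/-- The coordinates of a root with respect to the simple roots. -/
def coeff (i : ι) : b.support → ℤ := b.toWeightBasisInt.repr (P.rootSpanMem ℤ i)

/-- The coordinates of a coroot with respect to the simple coroots. -/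
def cocoeff (i : ι) : b.support → ℤ := coeff b.flip i

theorem root_eq_sum_coeff (i : ι) : P.root i = ∑ k, coeff b i k • P.root k := by
  have h := congrArg (Subtype.val) (b.toWeightBasisInt.sum_repr (P.rootSpanMem ℤ i))
  simpa [coeff] using h.symm

theorem coroot_eq_sum_cocoeff (i : ι) : P.coroot i = ∑ k, cocoeff b i k • P.coroot k :=
  root_eq_sum_coeff b.flip i

theorem eq_of_sum_smul_root_eq {c d : b.support → ℤ}
    (h : ∑ k, c k • P.root k = ∑ k, d k • P.root k) : c = d :=
  funext <| Fintype.linearIndependent_iffₛ.mp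
    (b.linearIndepOn_root.restrict_scalars' ℤ) c d (by simpa using h)

theorem eq_of_sum_smul_coroot_eq {c d : b.support → ℤ}
    (h : ∑ k, c k • P.coroot k = ∑ k, d k • P.coroot k) : c = d :=
  eq_of_sum_smul_root_eq b.flip h

theorem coeff_eq {i : ι} {c : b.support → ℤ} (h : P.root i = ∑ k, c k • P.root k) :
    coeff b i = c :=
  eq_of_sum_smul_root_eq b ((root_eq_sum_coeff b i).symm.trans h)

theorem coeff_eq_add_smul {i j k : ι} {z : ℤ} (h : P.root k = P.root i + z • P.root j) :
    coeff b k = coeff b i + z • coeff b j := by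
  refine coeff_eq b ?_
  rw [h, root_eq_sum_coeff b i, root_eq_sum_coeff b j]
  simp [add_smul, Finset.sum_add_distrib, Finset.smul_sum, mul_smul]

theorem coeff_injective : Function.Injective (coeff b) := fun i j h ↦
  P.root.injective <| by rw [root_eq_sum_coeff b i, root_eq_sum_coeff b j, h]

@[simp]
theorem coeff_simple [DecidableEq b.support] (k : b.support) : coeff b k = Pi.single k 1 :=
  coeff_eq b <| by simp [Pi.single_apply, ite_smul]

@[simp]
theorem coeff_simple_self (k : b.support) : coeff b k k = 1 := by
  classical
  simp

theorem coeff_simple_of_ne {k l : b.support} (h : l ≠ k) : coeff b k l = 0 := by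
  classical
  simp [h]

theorem coeff_simple_nonneg (k : b.support) : 0 ≤ coeff b k := by
  classical
  simp

theorem coeff_ne_zero (i : ι) : coeff b i ≠ 0 := fun h ↦ P.ne_zero i <| by
  rw [root_eq_sum_coeff b i, h]
  simp

theorem height_eq_sum_coeff (i : ι) : b.height i = ∑ k, coeff b i k := by
  classical
  let f : ι → ℤ := fun j ↦ if h : j ∈ b.support then coeff b i ⟨j, h⟩ else 0
  have hf (k : b.support) : f k = coeff b i k := by simp [f]
  have : P.root i = ∑ j ∈ b.support, f j • P.root j := by
    rw [root_eq_sum_coeff b i, ← Finset.sum_coe_sort b.support]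
    simp [hf]
  rw [Base.height_eq_sum this, ← Finset.sum_coe_sort b.support]
  simp [hf]

omit [CharZero R] in
theorem image_support_eq : P.root '' b.support = (fun k : b.support ↦ P.root k) '' univ := by
  rw [image_univ, image_eq_range]
  rfl

theorem coeff_nonneg_or_nonpos (i : ι) : 0 ≤ coeff b i ∨ coeff b i ≤ 0 := by
  have key (x : M) (hx : x ∈ AddSubmonoid.closure (P.root '' b.support)) :
      ∃ c : b.support → ℤ, 0 ≤ c ∧ x = ∑ k, c k • P.root k := by
    rw [image_support_eq, mem_addSubmonoidClosure_image_iff] at hx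
    obtain ⟨c, hc, -, h⟩ := hx
    exact ⟨c, hc, h⟩
  rcases b.root_mem_or_neg_mem i with h | h
  · obtain ⟨c, hc, h⟩ := key _ h
    exact .inl (coeff_eq b h ▸ hc)
  · obtain ⟨c, hc, h⟩ := key _ h
    have : coeff b i = -c := coeff_eq b <| by
      rw [← neg_neg (P.root i), h]
      simp
    exact .inr (by simpa [this] using hc)

/-- The height is the sum of the coordinates, which all have one sign. A sum of non-positive
coordinates can be non-negative only if all of them vanish. -/
theorem isPos_iff_coeff {i : ι} : b.IsPos i ↔ 0 ≤ coeff b i := by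
  rw [Base.isPos_iff', height_eq_sum_coeff]
  refine ⟨fun h ↦ ?_, fun h ↦ Finset.sum_nonneg fun k _ ↦ h k⟩
  rcases coeff_nonneg_or_nonpos b i with h' | h'
  · exact h'
  · have h0 := (Finset.sum_eq_zero_iff_of_nonpos fun k _ ↦ h' k).mp
      (le_antisymm (Finset.sum_nonpos fun k _ ↦ h' k) h)
    exact fun k ↦ (h0 k (Finset.mem_univ k)).ge

theorem not_isPos_iff_coeff {i : ι} : ¬ b.IsPos i ↔ coeff b i ≤ 0 := by
  rw [isPos_iff_coeff]
  refine ⟨(coeff_nonneg_or_nonpos b i).resolve_left, fun h h' ↦ ?_⟩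
  exact coeff_ne_zero b i (le_antisymm h h')

theorem isPos_of_coeff_pos {i : ι} {k : b.support} (h : 0 < coeff b i k) : b.IsPos i := by
  by_contra hi
  exact (not_lt.mpr ((not_isPos_iff_coeff b).mp hi k)) h

theorem not_isPos_of_coeff_neg {i : ι} {k : b.support} (h : coeff b i k < 0) : ¬ b.IsPos i :=
  fun hi ↦ (not_lt.mpr ((isPos_iff_coeff b).mp hi k)) h

theorem rootLE_iff_coeff_le {i j : ι} : RootLE b i j ↔ coeff b i ≤ coeff b j := by
  rw [RootLE, image_support_eq, mem_addSubmonoidClosure_image_iff]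
  refine ⟨?_, fun h ↦ ⟨coeff b j - coeff b i, sub_nonneg.mpr h, by simp, ?_⟩⟩
  · rintro ⟨c, hc, -, h⟩
    have : coeff b j = coeff b i + c := coeff_eq b <| by
      rw [sub_eq_iff_eq_add, root_eq_sum_coeff b i] at h
      rw [h]
      simp [add_smul, Finset.sum_add_distrib, add_comm]
    simpa [this] using hc
  · rw [root_eq_sum_coeff b i, root_eq_sum_coeff b j]
    simp [sub_smul, Finset.sum_sub_distrib]

theorem mem_posRootsP_iff {i : ι} :
    i ∈ posRootsP b J ↔ b.IsPos i ∧ ∀ k ∉ J, coeff b i k = 0 := by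
  refine and_congr_right fun _ ↦ ?_
  rw [mem_addSubgroupClosure_image_iff]
  refine ⟨?_, fun h ↦ ⟨_, h, root_eq_sum_coeff b i⟩⟩
  rintro ⟨c, hc, h⟩
  rwa [coeff_eq b h]

theorem mem_posRoots_diff_iff {i : ι} :
    i ∈ posRoots b \ posRootsP b J ↔ ∃ k ∉ J, 0 < coeff b i k := by
  rw [mem_sdiff, mem_posRootsP_iff]
  refine ⟨fun ⟨h, h'⟩ ↦ ?_, fun ⟨k, hk, h⟩ ↦ ?_⟩
  · replace h : b.IsPos i := h
    simp only [h, true_and, not_forall] at h'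
    obtain ⟨k, hk, h'⟩ := h'
    exact ⟨k, hk, lt_of_le_of_ne ((isPos_iff_coeff b).mp h k) (Ne.symm h')⟩
  · exact ⟨isPos_of_coeff_pos b h, fun h' ↦ h.ne' (h'.2 k hk)⟩

theorem corootClass_eq_sum (i : ι) :
    corootClass b J i = ∑ k, cocoeff b i k • corootClass b J k := by
  simp only [corootClass, ← QuotientAddGroup.mk_zsmul, ← QuotientAddGroup.mk_sum]
  congr 1
  ext
  simpa using coroot_eq_sum_cocoeff b i

theorem corootClass_simple_eq_zero {k : b.support} (hk : k ∈ J) : corootClass b J k = 0 := by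
  rw [corootClass, QuotientAddGroup.eq_zero_iff]
  exact AddSubgroup.mem_addSubgroupOf.mpr (AddSubgroup.subset_closure ⟨k, hk, rfl⟩)

theorem eq_of_sum_smul_corootClass_eq {c d : b.support → ℤ}
    (h : ∑ k, c k • corootClass b J k = ∑ k, d k • corootClass b J k) {k : b.support}
    (hk : k ∉ J) : c k = d k := by
  simp only [corootClass, ← QuotientAddGroup.mk_zsmul, ← QuotientAddGroup.mk_sum] at h
  rw [QuotientAddGroup.eq, AddSubgroup.mem_addSubgroupOf] at h
  simp only [corootLatticeP] at h
  rw [mem_addSubgroupClosure_image_iff] at h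
  obtain ⟨e, he, h⟩ := h
  have : d = c + e := eq_of_sum_smul_coroot_eq b <| by
    simp only [Pi.add_apply, add_smul, Finset.sum_add_distrib, ← h]
    simp
  simp [this, he k hk]

/-- The classes of the simple coroots outside `J` are independent in `H₂(X)` and those in `J` are
zero, so the order is coordinatewise outside `J`. -/
theorem degreeLE_corootClass_iff {i j : ι} :
    DegreeLE b J (corootClass b J i) (corootClass b J j) ↔
      ∀ k ∉ J, cocoeff b i k ≤ cocoeff b j k := by
  classical
  rw [DegreeLE, mem_addSubmonoidClosure_image_iff]
  refine ⟨?_, fun h ↦ ?_⟩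
  · rintro ⟨c, hc, -, h⟩ k hk
    rw [sub_eq_iff_eq_add, corootClass_eq_sum b J i, corootClass_eq_sum b J j,
      ← Finset.sum_add_distrib] at h
    have := eq_of_sum_smul_corootClass_eq b J (d := fun k ↦ c k + cocoeff b i k)
      (h.trans (Finset.sum_congr rfl fun k _ ↦ (add_zsmul _ _ _).symm)) hk
    exact this ▸ le_add_of_nonneg_left (hc k)
  · refine ⟨fun k ↦ if k ∈ J then 0 else cocoeff b j k - cocoeff b i k, fun k ↦ ?_, by simp +contextual, ?_⟩
    · by_cases hk : k ∈ J <;> simp [hk, h]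
    · rw [corootClass_eq_sum b J i, corootClass_eq_sum b J j, ← Finset.sum_sub_distrib]
      refine Finset.sum_congr rfl fun k _ ↦ ?_
      by_cases hk : k ∈ J
      · simp [hk, corootClass_simple_eq_zero]
      · simp only [if_neg hk]; rw [sub_zsmul, sub_eq_add_neg]

end Coordinates

/-! ### Root lengths, and the effect of reflections on coordinates. -/

section Lengths

variable {ι R M N : Type*} [CommRing R] [CharZero R] [AddCommGroup M] [Module R M]
  [AddCommGroup N] [Module R N] (P : RootPairing ι R M N) (b : P.Base)
  [Fintype ι] [P.IsCrystallographic]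

/-- The squared length of a root for the canonical invariant form. -/
def sqLength (i : ι) : ℤ := (P.posRootForm ℤ).rootLength i

theorem sqLength_pos (i : ι) : 0 < sqLength P i := (P.posRootForm ℤ).rootLength_pos i

theorem pairingIn_mul_sqLength (i j : ι) :
    P.pairingIn ℤ j i * sqLength P i = P.pairingIn ℤ i j * sqLength P j :=
  (P.posRootForm ℤ).pairingIn_mul_eq_pairingIn_mul_swap i j

theorem intCast_sqLength (i : ι) : (sqLength P i : R) = P.RootForm (P.root i) (P.root i) := by
  simpa using! (P.posRootForm ℤ).algebraMap_rootLength i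

@[simp]
theorem sqLength_reflectionPerm (i j : ι) : sqLength P (P.reflectionPerm i j) = sqLength P j := by
  refine Int.cast_injective (α := R) ?_
  rw [intCast_sqLength, intCast_sqLength, root_reflectionPerm,
    P.rootForm_reflection_reflection_apply]

variable {P}

/-- Under the invariant form, `α^∨` is `2α/|α|²`; expanding `α` in simple roots rescales each
coordinate by a ratio of squared lengths. -/
theorem cocoeff_mul_sqLength (i : ι) (k : b.support) :
    cocoeff b i k * sqLength P i = coeff b i k * sqLength P k := by
  have h (j : ι) : sqLength P j • P.coroot j = 2 • P.Polarization (P.root j) := by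
    rw [← P.rootForm_self_smul_coroot j, ← intCast_sqLength, Int.cast_smul_eq_zsmul]
  have key : ∑ k, (cocoeff b i k * sqLength P i) • P.coroot k =
      ∑ k, (coeff b i k * sqLength P k) • P.coroot k := by
    calc _ = sqLength P i • P.coroot i := by
          rw [coroot_eq_sum_cocoeff b i, Finset.smul_sum]
          exact Finset.sum_congr rfl fun k _ ↦ by rw [mul_comm, mul_smul]
      _ = 2 • P.Polarization (∑ k, coeff b i k • P.root k) := by
          rw [h, ← root_eq_sum_coeff]
      _ = _ := by
          rw [map_sum, Finset.smul_sum]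
          refine Finset.sum_congr rfl fun k _ ↦ ?_
          rw [map_zsmul, smul_comm, ← h, mul_smul]
  exact congrFun (eq_of_sum_smul_coroot_eq b key) k

omit [Fintype ι] in
theorem pairingIn_eq_sum (i j : ι) :
    P.pairingIn ℤ i j = ∑ k, coeff b i k * P.pairingIn ℤ k j := by
  refine Int.cast_injective (α := R) ?_
  have h := congrArg (P.coroot' j) (root_eq_sum_coeff b i)
  have (i j : ι) : ((P.pairingIn ℤ i j : ℤ) : R) = P.pairing i j := P.algebraMap_pairingIn ℤ i j
  simpa [this] using h

end Lengths

section Reflections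

variable {ι R M N : Type*} [CommRing R] [CharZero R] [AddCommGroup M] [Module R M]
  [AddCommGroup N] [Module R N] {P : RootPairing ι R M N} (b : P.Base)
  [P.IsCrystallographic]

theorem coeff_reflectionPerm (i j : ι) :
    coeff b (P.reflectionPerm j i) = coeff b i - P.pairingIn ℤ i j • coeff b j := by
  rw [sub_eq_add_neg, ← neg_smul]
  refine coeff_eq_add_smul b ?_
  rw [root_reflectionPerm, reflection_apply_root' ℤ, neg_smul, sub_eq_add_neg]

theorem cocoeff_reflectionPerm (i j : ι) :
    cocoeff b (P.reflectionPerm j i) = cocoeff b i - P.pairingIn ℤ j i • cocoeff b j := by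
  have h := coeff_reflectionPerm b.flip i j
  have h' : P.flip.pairingIn ℤ i j = P.pairingIn ℤ j i := by
    refine Int.cast_injective (α := R) ?_
    exact (P.flip.algebraMap_pairingIn ℤ i j).trans (P.algebraMap_pairingIn ℤ j i).symm
  rw [h'] at h
  exact h

end Reflections

/-! ### Possible pairings of two roots and the resulting length ratios. -/

section PairingTable

variable {ι R M N : Type*} [CommRing R] [CharZero R] [IsDomain R] [AddCommGroup M] [Module R M]
  [AddCommGroup N] [Module R N] {P : RootPairing ι R M N} (b : P.Base)
  [Fintype ι] [P.IsCrystallographic]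

omit [IsDomain R] in
theorem pairingIn_eq_zero_of_swap {i j : ι} (h : P.pairingIn ℤ i j = 0) :
    P.pairingIn ℤ j i = 0 := by
  have := pairingIn_mul_sqLength P i j
  rw [h, zero_mul, mul_eq_zero] at this
  exact this.resolve_right (sqLength_pos P i).ne'

omit [IsDomain R] [Fintype ι] in
theorem pairingIn_reflectionPerm_left (i j k : ι) :
    P.pairingIn ℤ (P.reflectionPerm j i) k =
      P.pairingIn ℤ i k - P.pairingIn ℤ i j * P.pairingIn ℤ j k := by
  have h : P.root (P.reflectionPerm j i) =
      (1 : ℤ) • P.root i + (-P.pairingIn ℤ i j) • P.root j := by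
    rw [root_reflectionPerm, reflection_apply_root' ℤ, neg_smul, one_smul, sub_eq_add_neg]
  rw [pairingIn_eq_add_of_root_eq_smul_add_smul h]
  simp [sub_eq_add_neg]

omit [IsDomain R] [Fintype ι] in
theorem pairingIn_eq_of_coeff_eq {i j k : ι} {z : ℤ} (h : coeff b i = coeff b j + z • coeff b k)
    (l : ι) : P.pairingIn ℤ i l = P.pairingIn ℤ j l + z * P.pairingIn ℤ k l := by
  rw [pairingIn_eq_sum b i, pairingIn_eq_sum b j, pairingIn_eq_sum b k, h, Finset.mul_sum,
    ← Finset.sum_add_distrib]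
  refine Finset.sum_congr rfl fun m _ ↦ ?_
  simp
  ring

omit [Fintype ι] in
theorem pairingIn_simple_nonpos [Finite ι] {k l : b.support} (h : k ≠ l) :
    P.pairingIn ℤ k l ≤ 0 :=
  b.pairingIn_le_zero_of_ne (Subtype.coe_ne_coe.mpr h) k.2 l.2

variable [P.IsReduced]

variable (P) in
/-- The possible pairings of two roots, together with the resulting ratios of their lengths. -/
theorem pairingIn_sqLength_cases (i j : ι) :
    (P.pairingIn ℤ i j = 0 ∧ P.pairingIn ℤ j i = 0) ∨
    (P.pairingIn ℤ i j = 1 ∧ P.pairingIn ℤ j i = 1 ∧ sqLength P i = sqLength P j) ∨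
    (P.pairingIn ℤ i j = -1 ∧ P.pairingIn ℤ j i = -1 ∧ sqLength P i = sqLength P j) ∨
    (P.pairingIn ℤ i j = 1 ∧ P.pairingIn ℤ j i = 2 ∧ sqLength P j = 2 * sqLength P i) ∨
    (P.pairingIn ℤ i j = 2 ∧ P.pairingIn ℤ j i = 1 ∧ sqLength P i = 2 * sqLength P j) ∨
    (P.pairingIn ℤ i j = -1 ∧ P.pairingIn ℤ j i = -2 ∧ sqLength P j = 2 * sqLength P i) ∨
    (P.pairingIn ℤ i j = -2 ∧ P.pairingIn ℤ j i = -1 ∧ sqLength P i = 2 * sqLength P j) ∨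
    (P.pairingIn ℤ i j = 1 ∧ P.pairingIn ℤ j i = 3 ∧ sqLength P j = 3 * sqLength P i) ∨
    (P.pairingIn ℤ i j = 3 ∧ P.pairingIn ℤ j i = 1 ∧ sqLength P i = 3 * sqLength P j) ∨
    (P.pairingIn ℤ i j = -1 ∧ P.pairingIn ℤ j i = -3 ∧ sqLength P j = 3 * sqLength P i) ∨
    (P.pairingIn ℤ i j = -3 ∧ P.pairingIn ℤ j i = -1 ∧ sqLength P i = 3 * sqLength P j) ∨
    (P.pairingIn ℤ i j = 2 ∧ P.pairingIn ℤ j i = 2 ∧ i = j) ∨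
    (P.pairingIn ℤ i j = -2 ∧ P.pairingIn ℤ j i = -2 ∧ P.root i = -P.root j) := by
  have : Module.IsReflexive R M := .of_isPerfPair P.toLinearMap
  have : IsAddTorsionFree M := .of_isTorsionFree R M
  have hL := pairingIn_mul_sqLength P i j
  have h2 := P.pairingIn_two_two_iff ℤ i j
  have h3 := P.pairingIn_neg_two_neg_two_iff ℤ i j
  have h := P.pairingIn_pairingIn_mem_set_of_isCrystal_of_isRed i j
  simp only [mem_insert_iff, mem_singleton_iff, Prod.mk.injEq] at h
  rcases h with h | h | h | h | h | h | h | h | h | h | h | h | h <;>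
    simp only [h.1, h.2] at hL ⊢ <;> norm_num
  any_goals omega
  · exact h2.mp h
  · exact P.root.injective (by simpa using h3.mp h)

theorem eq_of_sqLength_eq_of_pairingIn {i j : ι} (hL : sqLength P i = sqLength P j)
    (h : P.pairingIn ℤ i j = 2) : i = j := by
  have := sqLength_pos P i
  rcases pairingIn_sqLength_cases P i j with h' | h' | h' | h' | h' | h' | h' | h' | h' | h' | h' |
    h' | h'
  any_goals omega
  exact h'.2.2

theorem coeff_eq_neg_of_sqLength_eq_of_pairingIn {i j : ι} (hL : sqLength P i = sqLength P j)
    (h : P.pairingIn ℤ i j = -2) : coeff b i = -coeff b j := by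
  have h' : P.reflectionPerm i i = j :=
    eq_of_sqLength_eq_of_pairingIn (P := P) (by simpa using hL) (by simp [h])
  rw [← h', coeff_reflectionPerm]
  simp [two_smul]

theorem pairingIn_of_sqLength_lt {i j : ι} (hL : sqLength P j < sqLength P i)
    (h : 0 < P.pairingIn ℤ i j) :
    P.pairingIn ℤ j i = 1 ∧ sqLength P i = P.pairingIn ℤ i j * sqLength P j ∧
      2 ≤ P.pairingIn ℤ i j := by
  have := sqLength_pos P i
  have := sqLength_pos P j
  rcases pairingIn_sqLength_cases P i j with h' | h' | h' | h' | h' | h' | h' | h' | h' | h' | h' |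
    h' | h'
  any_goals omega
  · rw [h'.1]; omega
  · rw [h'.1]; omega
  · rw [h'.2.2] at hL; omega

theorem sqLength_ratio {i j : ι} (h : P.pairingIn ℤ i j ≠ 0) :
    sqLength P i = sqLength P j ∨ sqLength P i = 2 * sqLength P j ∨
      sqLength P i = 3 * sqLength P j ∨ sqLength P j = 2 * sqLength P i ∨
      sqLength P j = 3 * sqLength P i := by
  rcases pairingIn_sqLength_cases P i j with h' | h' | h' | h' | h' | h' | h' | h' | h' | h' | h' |
    h' | h'
  any_goals omega
  all_goals
    left
    have := pairingIn_mul_sqLength P i j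
    rw [h'.1, h'.2.1] at this
    omega

end PairingTable

/-! ### At most two root lengths occur in a connected component. -/

section TwoLengths

variable {ι R M N : Type*} [CommRing R] [CharZero R] [IsDomain R] [AddCommGroup M] [Module R M]
  [AddCommGroup N] [Module R N] {P : RootPairing ι R M N} {b : P.Base}
  [Fintype ι] [P.IsCrystallographic]

omit [IsDomain R] [Fintype ι] [P.IsCrystallographic] in
theorem coeff_simple_le_iff {k : b.support} {x : b.support → ℤ} (hx : 0 ≤ x) :
    coeff b k ≤ x ↔ 0 < x k := by
  refine ⟨fun h ↦ by simpa [Int.lt_iff_add_one_le] using h k, fun h l ↦ ?_⟩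
  by_cases hl : l = k
  · subst hl
    simpa [Int.lt_iff_add_one_le] using h
  · simpa [coeff_simple_of_ne b hl] using hx l

/-- If the roots are partitioned into two mutually orthogonal sets, then the simple roots in the
support of a positive root all lie in the same set. -/
theorem support_subset_or_disjoint {T : Set ι}
    (hT : ∀ i ∈ T, ∀ j ∉ T, P.pairingIn ℤ i j = 0) {i : ι} (hi : b.IsPos i) :
    (∀ k : b.support, coeff b i k ≠ 0 → (k : ι) ∈ T) ∨
      ∀ k : b.support, coeff b i k ≠ 0 → (k : ι) ∉ T := by
  have hT' : ∀ i ∉ T, ∀ j ∈ T, P.pairingIn ℤ i j = 0 := fun i hi j hj ↦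
    pairingIn_eq_zero_of_swap (hT j hj i hi)
  -- If `i` and the simple root `j` were on different sides, they would be orthogonal and `s_j (i +
  -- j) = i - j` would be a root with coordinates of both signs.
  have key (U : Set ι) (hU : ∀ i ∈ U, ∀ j ∉ U, P.pairingIn ℤ i j = 0) (i j k : ι)
      (hk : P.root k = P.root i + P.root j) (hi : ∀ l : b.support, coeff b i l ≠ 0 → (l : ι) ∈ U)
      (hipos : b.IsPos i) (hj : j ∈ b.support) (hjU : j ∉ U) : False := by
    have hij : P.pairingIn ℤ i j = 0 := by
      rw [pairingIn_eq_sum b]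
      refine Finset.sum_eq_zero fun l _ ↦ ?_
      by_cases hl : coeff b i l = 0
      · simp [hl]
      · simp [hU l (hi l hl) j hjU]
    have hkc : coeff b k = coeff b i + (1 : ℤ) • coeff b j :=
      coeff_eq_add_smul b (by simpa using hk)
    have hkj : P.pairingIn ℤ k j = 2 := by
      rw [pairingIn_eq_of_coeff_eq b hkc, hij]
      simp
    have hr : coeff b (P.reflectionPerm j k) = coeff b i - coeff b j := by
      rw [coeff_reflectionPerm, hkj, hkc]
      module
    lift j to b.support using hj
    have hij0 : coeff b i j = 0 := by
      by_contra h
      exact hjU (hi j h)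
    have hneg : coeff b (P.reflectionPerm j k) ≤ 0 := by
      rw [← not_isPos_iff_coeff]
      refine not_isPos_of_coeff_neg b (k := j) ?_
      simp [hr, hij0]
    refine coeff_ne_zero b i (le_antisymm (fun l ↦ ?_) ((isPos_iff_coeff b).mp hipos))
    by_cases hl : l = j
    · simp [hl, hij0]
    · have := hneg l
      simpa [hr, coeff_simple_of_ne b hl] using this
  have simple (k : b.support) {l : b.support} (h : coeff b k l ≠ 0) : l = k := by
    by_contra hl
    exact h (coeff_simple_of_ne b hl)
  suffices b.IsPos i → (∀ k : b.support, coeff b i k ≠ 0 → (k : ι) ∈ T) ∨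
      ∀ k : b.support, coeff b i k ≠ 0 → (k : ι) ∉ T from this hi
  refine hi.induction_on_add (p := fun i ↦ b.IsPos i →
    (∀ k : b.support, coeff b i k ≠ 0 → (k : ι) ∈ T) ∨
      ∀ k : b.support, coeff b i k ≠ 0 → (k : ι) ∉ T) (fun j hj _ ↦ ?_) fun i j k hk ih hj hkpos ↦ ?_
  · lift j to b.support using hj
    by_cases hjT : (j : ι) ∈ T
    · exact .inl fun k hk ↦ simple j hk ▸ hjT
    · exact .inr fun k hk ↦ simple j hk ▸ hjT
  · have hipos : b.IsPos i := hkpos.sub hj (by rw [hk, add_sub_cancel_right])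
    have supp (U : Set ι) (hi : ∀ l : b.support, coeff b i l ≠ 0 → (l : ι) ∈ U) (hjU : j ∈ U)
        (l : b.support) (hl : coeff b k l ≠ 0) : (l : ι) ∈ U := by
      have hkc : coeff b k = coeff b i + (1 : ℤ) • coeff b j :=
        coeff_eq_add_smul b (by simpa using hk)
      by_cases hl' : coeff b i l = 0
      · lift j to b.support using hj
        have : l = j := simple j fun h ↦ hl (by simp [hkc, hl', h])
        exact this ▸ hjU
      · exact hi l hl'
    by_cases hjT : j ∈ T <;> rcases ih hipos with ih | ih
    · exact .inl (supp T ih hjT)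
    · exact (key Tᶜ (fun i hi j hj ↦ hT' i hi j (not_not.mp hj)) i j k hk ih hipos hj
        (not_not.mpr hjT)).elim
    · exact (key T hT i j k hk ih hipos hj hjT).elim
    · exact .inr (supp Tᶜ ih hjT)

/-- Let `T` be the set of roots orthogonal to every root of the length of `j`. Reflections preserve
length, so `T` is orthogonal to its complement. The support of `j` then lies on one side; since it
contains the support of `i`, having `i ∈ T` would make `i` or `j` orthogonal to itself. -/
theorem exists_pairingIn_ne_zero {i j : ι} (hi : b.IsPos i) (h : coeff b i ≤ coeff b j) :
    ∃ k, sqLength P k = sqLength P j ∧ P.pairingIn ℤ k i ≠ 0 := by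
  by_contra! hi'
  let T : Set ι := {i | ∀ k, sqLength P k = sqLength P j → P.pairingIn ℤ k i = 0}
  have hT : ∀ i ∈ T, ∀ j ∉ T, P.pairingIn ℤ i j = 0 := by
    intro i hi l hl
    simp only [T, mem_ofPred_eq, not_forall] at hl
    obtain ⟨k, hk, hkl⟩ := hl
    have := hi (P.reflectionPerm l k) (by simpa using hk)
    rw [pairingIn_reflectionPerm_left, hi k hk, zero_sub, neg_eq_zero, mul_eq_zero] at this
    exact pairingIn_eq_zero_of_swap (this.resolve_left hkl)
  have hjT : j ∉ T := fun h ↦ by simpa using h j rfl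
  have hjpos : b.IsPos j := (isPos_iff_coeff b).mpr (((isPos_iff_coeff b).mp hi).trans h)
  rcases support_subset_or_disjoint hT hjpos with hs | hs
  · have : P.pairingIn ℤ j j = 0 := by
      rw [pairingIn_eq_sum b]
      refine Finset.sum_eq_zero fun l _ ↦ ?_
      by_cases hl : coeff b j l = 0
      · simp [hl]
      · simp [hT l (hs l hl) j hjT]
    simp at this
  · have : P.pairingIn ℤ i i = 0 := by
      rw [pairingIn_eq_sum b]
      refine Finset.sum_eq_zero fun l _ ↦ ?_
      by_cases hl : coeff b i l = 0
      · simp [hl]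
      · have hl' : coeff b j l ≠ 0 := fun h' ↦
          hl (le_antisymm (h' ▸ h l) ((isPos_iff_coeff b).mp hi l))
        simp [pairingIn_eq_zero_of_swap (hT i hi' l (hs l hl'))]
    simp at this

variable [P.IsReduced]

/-- A pairing of `-2` or `-3` would make `α` longer than `k`. Both are non-orthogonal to roots of
the length of `β`, so the ratio of squared lengths of `β` and `k` would be 4, 6 or 9, whereas only
1, 2 and 3 are possible. -/
theorem pairingIn_simple_eq_neg_one {α β : ι} {k : b.support} (hα : b.IsPos α)
    (hαβ : coeff b α ≤ coeff b β) (hkβ : coeff b k ≤ coeff b β)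
    (hL : sqLength P α < sqLength P β) (hk : P.pairingIn ℤ k α < 0) :
    P.pairingIn ℤ α k = -1 := by
  have h0 := sqLength_pos P (k : ι)
  obtain ⟨β₁, h₁, h₁'⟩ := exists_pairingIn_ne_zero hα hαβ
  obtain ⟨β₂, h₂, h₂'⟩ := exists_pairingIn_ne_zero (b.isPos_of_mem_support k.2) hkβ
  have r₁ := sqLength_ratio h₁'
  have r₂ := sqLength_ratio h₂'
  rw [h₁] at r₁
  rw [h₂] at r₂
  have hne : P.root k ≠ -P.root α := fun h ↦ by
    have h' : coeff b k = -coeff b α := coeff_eq b <| by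
      rw [h, root_eq_sum_coeff b α]
      simp
    have := ((isPos_iff_coeff b).mp hα) k
    have h'' := congrFun h' k
    simp only [coeff_simple_self, Pi.neg_apply, Pi.zero_apply] at this h''
    lia
  rcases pairingIn_sqLength_cases P k α with h' | h' | h' | h' | h' | h' | h' | h' | h' | h' | h' |
    h' | h'
  any_goals omega
  exact absurd h'.2.2 hne

end TwoLengths

/-! ### Finding a long root at an acute angle to a shorter one. -/

section LongRoots

variable {ι R M N : Type*} [CommRing R] [CharZero R] [IsDomain R] [AddCommGroup M] [Module R M]
  [AddCommGroup N] [Module R N] {P : RootPairing ι R M N} {b : P.Base}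
  [Fintype ι] [P.IsCrystallographic]

omit [IsDomain R] [Fintype ι] in
theorem exists_simple_pairingIn_neg {α β : ι} (h : coeff b α ≤ coeff b β)
    (hp : P.pairingIn ℤ β α ≤ 0) :
    ∃ k : b.support, coeff b α k < coeff b β k ∧ P.pairingIn ℤ k α < 0 := by
  by_contra! hk
  have h₁ : 0 ≤ ∑ k, (coeff b β k - coeff b α k) * P.pairingIn ℤ k α := by
    refine Finset.sum_nonneg fun k _ ↦ ?_
    rcases (h k).eq_or_lt with h' | h'
    · simp [h']
    · exact mul_nonneg (sub_nonneg.mpr h'.le) (hk k h')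
  simp only [sub_mul, Finset.sum_sub_distrib, ← pairingIn_eq_sum b, pairingIn_same] at h₁
  omega

variable [P.IsReduced]

/-- The descent step in rank two: `β` is long, `α` is short, `α + k = s_k α`, and the reflection
of `β` in the simple root `k` falls below `α`. Then we are in type `G₂` and `β = α + 2k`. -/
theorem coeff_eq_add_two_smul_of_reflection_le {α β : ι} {k : b.support}
    (hL : sqLength P α < sqLength P β) (hαk : P.pairingIn ℤ α k = -1)
    (hβα : 0 < P.pairingIn ℤ (P.reflectionPerm k β) α) (hβk : 0 < P.pairingIn ℤ β k)
    (hβ : ¬ coeff b β ≤ coeff b α + coeff b k)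
    (hle : coeff b (P.reflectionPerm k β) ≤ coeff b α) :
    P.pairingIn ℤ k α = -1 ∧ sqLength P β = 3 * sqLength P α ∧
      coeff b β = coeff b α + (2 : ℤ) • coeff b k := by
  have hα₀ := sqLength_pos P α
  set q := P.pairingIn ℤ β k with hq
  have hrc : coeff b (P.reflectionPerm k β) = coeff b β - q • coeff b k :=
    coeff_reflectionPerm b β k
  have hx : ∀ l ≠ k, coeff b β l ≤ coeff b α l := fun l hl ↦ by
    simpa [hrc, coeff_simple_of_ne b hl] using hle l
  have hxk : coeff b α k + 1 < coeff b β k := by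
    by_contra! h
    refine hβ fun l ↦ ?_
    by_cases hl : l = k
    · subst hl
      simpa using h
    · simpa [coeff_simple_of_ne b hl] using hx l hl
  -- Distinct simple roots pair non-positively, so coordinates away from `k` only help. The right
  -- side is at most `-4`, whence `(β, k^∨) ≥ 3`, which forces `G₂` ratios.
  have hsum : P.pairingIn ℤ α k - P.pairingIn ℤ β k ≤ 2 * (coeff b α k - coeff b β k) := by
    classical
    rw [pairingIn_eq_sum b α, pairingIn_eq_sum b β, ← Finset.sum_sub_distrib,
      ← Finset.add_sum_erase _ _ (Finset.mem_univ k)]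
    have : ∑ l ∈ Finset.univ.erase k, (coeff b α l * P.pairingIn ℤ l k -
        coeff b β l * P.pairingIn ℤ l k) ≤ 0 := by
      refine Finset.sum_nonpos fun l hl ↦ ?_
      rw [← sub_mul]
      exact mul_nonpos_of_nonneg_of_nonpos (sub_nonneg.mpr (hx l (Finset.ne_of_mem_erase hl)))
        (pairingIn_simple_nonpos b (Finset.ne_of_mem_erase hl))
    simp only [pairingIn_same]
    linarith
  have hβk' : P.pairingIn ℤ β k = 3 ∧ P.pairingIn ℤ k β = 1 ∧
      sqLength P β = 3 * sqLength P k := by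
    rcases pairingIn_sqLength_cases P β k with h | h | h | h | h | h | h | h | h | h | h | h | h
    all_goals omega
  obtain ⟨h₁, h₂, h₃⟩ := pairingIn_of_sqLength_lt (by simpa using hL) hβα
  rw [sqLength_reflectionPerm] at h₂
  have hkα : P.pairingIn ℤ k α = -1 ∧ sqLength P β = 3 * sqLength P α := by
    rcases pairingIn_sqLength_cases P k α with h | h | h | h | h | h | h | h | h | h | h | h | h
    any_goals omega
    · have := pairingIn_sqLength_cases P (P.reflectionPerm k β) α
      have h6 : P.pairingIn ℤ (P.reflectionPerm k β) α * sqLength P α = 6 * sqLength P α := by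
        omega
      have := mul_right_cancel₀ hα₀.ne' h6
      omega
    · have h6 : P.pairingIn ℤ (P.reflectionPerm k β) α * sqLength P α = 9 * sqLength P α := by
        omega
      have := mul_right_cancel₀ hα₀.ne' h6
      have := pairingIn_sqLength_cases P (P.reflectionPerm k β) α
      omega
  refine ⟨hkα.1, hkα.2, ?_⟩
  have hα'c : coeff b (P.reflectionPerm k α) = coeff b α + coeff b k := by
    rw [coeff_reflectionPerm, hαk]
    simp
  have hβα' : P.pairingIn ℤ (P.reflectionPerm k α) β = 1 := by
    rw [pairingIn_reflectionPerm_left, hαk, hβk'.2.1]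
    rw [pairingIn_reflectionPerm, pairingIn_reflectionPerm_left, hαk, hβk'.2.1] at h₁
    exact h₁
  -- The root `s_β (α + k) = α + k - β` has the length of `k` and pairs to `1 - 3 = -2` with `k^∨`,
  -- so it is `-k`.
  have hz : coeff b (P.reflectionPerm β (P.reflectionPerm k α)) = -coeff b k := by
    refine coeff_eq_neg_of_sqLength_eq_of_pairingIn b (by simp; omega) ?_
    rw [pairingIn_reflectionPerm_left, hβα', hβk'.1, pairingIn_reflectionPerm_left, hαk]
    simp
  rw [coeff_reflectionPerm, hβα', hα'c] at hz
  have : coeff b β = coeff b α + coeff b k + coeff b k := by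
    rw [one_smul, sub_eq_iff_eq_add] at hz
    rw [hz]
    abel
  rw [this]
  module

/-- The exceptional configuration in type `G₂` cannot be descended from further, unless `α` is
simple. -/
theorem eq_simple_of_coeff_eq_add_two_smul {α β : ι} {k c : b.support}
    (hαk : P.pairingIn ℤ α k = -1) (hkα : P.pairingIn ℤ k α < 0)
    (hc₁ : P.pairingIn ℤ (P.reflectionPerm k α) c = -1)
    (hc₂ : P.pairingIn ℤ c (P.reflectionPerm k α) = -1)
    (hL : sqLength P β = 3 * sqLength P α)
    (hα : 0 ≤ coeff b (P.reflectionPerm k α))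
    (hβ : coeff b β = coeff b (P.reflectionPerm k α) + (2 : ℤ) • coeff b c) :
    α = c ∧ coeff b β = (3 : ℤ) • coeff b c + coeff b k := by
  have hα₀ := sqLength_pos P α
  set α' := P.reflectionPerm k α with hα'
  have hα'c : coeff b α' = coeff b α + coeff b k := by
    rw [coeff_reflectionPerm, hαk]
    simp
  have hL' : sqLength P α' = sqLength P α := by simp [hα']
  have hα'k : P.pairingIn ℤ α' k = 1 := by
    rw [pairingIn_reflectionPerm_left, hαk]
    simp
  have hkα' : P.pairingIn ℤ k α' = -P.pairingIn ℤ k α := by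
    rw [hα', pairingIn_reflectionPerm, pairingIn_reflectionPerm_left]
    simp
    ring
  have hck : c ≠ k := by
    rintro rfl
    omega
  have hLc : sqLength P c = sqLength P α := by
    have := pairingIn_mul_sqLength P α' c
    rw [hc₁, hc₂] at this
    omega
  have hβk : P.pairingIn ℤ β k = 1 + 2 * P.pairingIn ℤ c k := by
    rw [pairingIn_eq_of_coeff_eq b hβ, hα'k]
  have hβc : P.pairingIn ℤ β c = 3 := by
    rw [pairingIn_eq_of_coeff_eq b hβ, hc₁]
    simp
  have hβα' : P.pairingIn ℤ β α' = 0 := by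
    rw [pairingIn_eq_of_coeff_eq b hβ, hc₂]
    simp
  have hck' := pairingIn_simple_nonpos b hck
  have hne : P.root c ≠ -P.root k :=
    b.root_ne_neg_of_ne c.2 k.2 (Subtype.coe_ne_coe.mpr hck)
  -- the root `-(2α' + c)`, which has the length of `β`
  have excluded (hkL : sqLength P k = 3 * sqLength P α) (hck0 : P.pairingIn ℤ c k = 0) :
      False := by
    set w := P.reflectionPerm α' c with hw
    have hwk : P.pairingIn ℤ w k = 1 := by
      rw [pairingIn_reflectionPerm_left, hc₂, hα'k, hck0]
      norm_num
    have hβw : P.pairingIn ℤ β w = 3 := by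
      rw [hw, pairingIn_reflectionPerm, pairingIn_reflectionPerm_left, hβα', hβc]
      norm_num
    have hwc : coeff b w = coeff b c + coeff b α' := by
      rw [hw, coeff_reflectionPerm, hc₂]
      simp
    -- This would give `k = 2α' + c`, although the simple root `k ≠ c` has coordinate zero at `c`.
    have h := coeff_eq_neg_of_sqLength_eq_of_pairingIn (P := P) b
      (i := P.reflectionPerm w β) (j := k) (by simp; omega)
      (by rw [pairingIn_reflectionPerm_left, hβk, hβw, hwk, hck0]; norm_num)
    rw [coeff_reflectionPerm, hβw, hβ, hwc] at h
    have h' := congrFun h c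
    have := hα c
    simp [coeff_simple_of_ne b hck] at h' this
    omega
  have hcase : P.pairingIn ℤ k c = -3 := by
    rcases pairingIn_sqLength_cases P k α' with h | h | h | h | h | h | h | h | h | h | h | h | h
    all_goals
      rcases pairingIn_sqLength_cases P c k with h' | h' | h' | h' | h' | h' | h' | h' | h' | h' |
        h' | h' | h'
    any_goals omega
    all_goals
      rcases pairingIn_sqLength_cases P β k with h'' | h'' | h'' | h'' | h'' | h'' | h'' | h'' |
        h'' | h'' | h'' | h'' | h''
    any_goals omega
    all_goals first | exact (excluded (by omega) (by omega)).elim | exact absurd h'.2.2 hne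
  have : α = c := by
    refine eq_of_sqLength_eq_of_pairingIn (P := P) hLc.symm ?_
    have h : coeff b α = coeff b α' + (-1 : ℤ) • coeff b k := by
      rw [hα'c]
      module
    rw [pairingIn_eq_of_coeff_eq b h, hc₁, hcase]
    norm_num
  refine ⟨this, ?_⟩
  rw [hβ, hα'c, this]
  module

/-- If a root `β` dominates a shorter root `α`, then some positive root below `β`, of the same
length as `β`, makes an acute angle with `α`, except for certain configurations in type `G₂`. -/
theorem exists_long_root_pairingIn_pos {α β : ι} (hα : b.IsPos α)
    (hαβ : coeff b α ≤ coeff b β) (hL : sqLength P α < sqLength P β) :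
    (∃ β', b.IsPos β' ∧ sqLength P β' = sqLength P β ∧ coeff b β' ≤ coeff b β ∧
      ¬ coeff b β' ≤ coeff b α ∧ 0 < P.pairingIn ℤ β' α) ∨
    (∃ (k : b.support) (β' : ι), P.pairingIn ℤ α k = -1 ∧ P.pairingIn ℤ k α = -1 ∧
      sqLength P β = 3 * sqLength P α ∧ sqLength P β' = sqLength P β ∧
      coeff b β' = coeff b α + (2 : ℤ) • coeff b k ∧ coeff b β' ≤ coeff b β) ∨
    (∃ k l : b.support, α = k ∧ P.pairingIn ℤ l α < 0 ∧ sqLength P β = 3 * sqLength P α ∧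
      (3 : ℤ) • coeff b k + coeff b l ≤ coeff b β) := by
  -- While `β` is not acute to `α`, replace `α` by `s_k α = α + k ≤ β`; a root acute to `s_k α` is
  -- carried by `s_k` to one acute to `α`. The clause that `β'` is not below `α` serves this
  -- induction: it keeps `β' ≠ k`, so that `s_k β'` stays positive, and it isolates the `G₂`
  -- exception.
  induction hn : (b.height β - b.height α).toNat using Nat.strong_induction_on generalizing α with
  | _ n ih =>
  by_cases hp : 0 < P.pairingIn ℤ β α
  · refine .inl ⟨β, (isPos_iff_coeff b).mpr (((isPos_iff_coeff b).mp hα).trans hαβ), rfl, le_rfl,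
      fun h ↦ hL.ne ?_, hp⟩
    rw [coeff_injective b (le_antisymm hαβ h)]
  obtain ⟨k, hk, hkα⟩ := exists_simple_pairingIn_neg hαβ (not_lt.mp hp)
  have hα₀ := (isPos_iff_coeff b).mp hα
  have hkβ : coeff b k ≤ coeff b β :=
    (coeff_simple_le_iff (hα₀.trans hαβ)).mpr ((hα₀ k).trans_lt hk)
  have hαk : P.pairingIn ℤ α k = -1 := pairingIn_simple_eq_neg_one hα hαβ hkβ hL hkα
  set α' := P.reflectionPerm k α with hα'
  have hα'c : coeff b α' = coeff b α + coeff b k := by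
    rw [coeff_reflectionPerm, hαk]
    simp
  have hαα' : coeff b α ≤ coeff b α' := by
    rw [hα'c]
    exact le_add_of_nonneg_right (coeff_simple_nonneg b k)
  have hkα' : coeff b k ≤ coeff b α' := by
    rw [hα'c]
    exact le_add_of_nonneg_left hα₀
  have hα'β : coeff b α' ≤ coeff b β := by
    intro l
    by_cases hl : l = k
    · subst hl
      simpa [hα'c] using! hk
    · simpa [hα'c, coeff_simple_of_ne b hl] using hαβ l
  have hα'₀ : 0 ≤ coeff b α' := hα₀.trans hαα'
  have hht : b.height α' = b.height α + 1 := by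
    have : ∑ l, coeff b k l = 1 := by
      rw [← height_eq_sum_coeff, Base.height_one_of_mem_support k.2]
    rw [height_eq_sum_coeff, height_eq_sum_coeff, hα'c, ← this, ← Finset.sum_add_distrib]
    rfl
  have hht' : b.height α' ≤ b.height β := by
    rw [height_eq_sum_coeff, height_eq_sum_coeff]
    exact Finset.sum_le_sum fun l _ ↦ hα'β l
  have hL' : sqLength P α' = sqLength P α := by simp [hα']
  have hpα' (i : ι) : P.pairingIn ℤ i α' = P.pairingIn ℤ (P.reflectionPerm k i) α :=
    pairingIn_reflectionPerm P ℤ k i α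
  rcases ih _ (by omega) ((isPos_iff_coeff b).mpr hα'₀) hα'β (by omega) rfl with
    ⟨β', h₁, h₂, h₃, h₄, h₅⟩ | ⟨c, β', h₁, h₂, h₃, h₄, h₅, h₆⟩ | ⟨c, l, h₁, h₂⟩
  · rw [hpα'] at h₅
    by_cases hq : 0 < P.pairingIn ℤ β' k
    · by_cases hle : coeff b (P.reflectionPerm k β') ≤ coeff b α
      · obtain ⟨h₆, h₇, h₈⟩ := coeff_eq_add_two_smul_of_reflection_le (h₂ ▸ hL) hαk h₅ hq
          (hα'c ▸ h₄) hle
        exact .inr (.inl ⟨k, β', hαk, h₆, h₂ ▸ h₇, h₂, h₈, h₃⟩)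
      · refine .inl ⟨_, h₁.reflectionPerm k.2 (fun h ↦ h₄ (h ▸ hkα')), by simpa using h₂, ?_, hle,
          h₅⟩
        rw [coeff_reflectionPerm]
        exact (sub_le_self _ (smul_nonneg hq.le (coeff_simple_nonneg b k))).trans h₃
    · refine .inl ⟨β', h₁, h₂, h₃, fun h ↦ h₄ (h.trans hαα'), ?_⟩
      rw [pairingIn_reflectionPerm_left] at h₅
      have := mul_nonneg_of_nonpos_of_nonpos (not_lt.mp hq) hkα.le
      omega
  · obtain ⟨h₇, h₈⟩ := eq_simple_of_coeff_eq_add_two_smul hαk hkα h₁ h₂ (by omega) hα'₀ h₅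
    exact .inr (.inr ⟨c, k, h₇, hkα, by omega, h₈ ▸ h₆⟩)
  -- The root `α' = α + k` has height at least 2, so it is not simple.
  · have := Base.height_one_of_mem_support c.2
    have := b.isPos_iff.mp hα
    rw [h₁] at hht
    omega

end LongRoots

/-! ### Equivalence of (a) and (c). -/

section Cosmall

variable {ι R M N : Type*} [CommRing R] [CharZero R] [IsDomain R] [AddCommGroup M] [Module R M]
  [AddCommGroup N] [Module R N] {P : RootPairing ι R M N} {b : P.Base} {J : Set b.support}
  [Fintype ι] [P.IsCrystallographic]

omit [IsDomain R] in
theorem cocoeff_nonneg {i : ι} {k : b.support} (h : 0 ≤ coeff b i k) : 0 ≤ cocoeff b i k := by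
  refine nonneg_of_mul_nonneg_left ?_ (sqLength_pos P i)
  rw [cocoeff_mul_sqLength]
  exact mul_nonneg h (sqLength_pos P k).le

omit [IsDomain R] in
theorem cocoeff_eq_zero {i : ι} {k : b.support} (h : coeff b i k = 0) : cocoeff b i k = 0 := by
  have := cocoeff_mul_sqLength b i k
  rw [h, zero_mul] at this
  exact (mul_eq_zero.mp this).resolve_right (sqLength_pos P i).ne'

omit [IsDomain R] [Fintype ι] in
theorem coeff_reflectionPerm_self (i : ι) : coeff b (P.reflectionPerm i i) = -coeff b i := by
  rw [coeff_reflectionPerm, pairingIn_same]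
  module

omit [IsDomain R] [Fintype ι] in
theorem cocoeff_reflectionPerm_self (i : ι) :
    cocoeff b (P.reflectionPerm i i) = -cocoeff b i := by
  rw [cocoeff_reflectionPerm, pairingIn_same]
  module

/-- The root `α` pairs non-negatively with the positive roots of `P`. -/
def IsDominantP (b : P.Base) (J : Set b.support) (α : ι) : Prop :=
  ∀ δ ∈ posRootsP b J, 0 ≤ P.pairingIn ℤ δ α

/-- The roots outside `R⁺_P` inverted by `s_α`, other than `α`, pair to `1` with `α^∨`. -/
def HasUnitPairings (b : P.Base) (J : Set b.support) (α : ι) : Prop :=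
  ∀ γ ∈ posRoots b \ posRootsP b J, γ ≠ α → ¬ b.IsPos (P.reflectionPerm α γ) →
    P.pairingIn ℤ γ α = 1

-- For `δ ∈ R⁺_P`, the coordinates of `s_α δ` outside `J` are those of `-(δ, α^∨) α`, so the sign of
-- the pairing decides whether `s_α δ` lies in `R⁺ \ R⁺_P`.
omit [IsDomain R] [Fintype ι] in
theorem isDominantP_iff {α : ι} (hα : α ∈ posRoots b \ posRootsP b J) :
    (posRoots b \ posRootsP b J) ∩ (P.reflectionPerm α '' posRootsP b J) = ∅ ↔
      IsDominantP b J α := by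
  have hpos : ∀ k, 0 ≤ coeff b α k := (isPos_iff_coeff b).mp hα.1
  obtain ⟨k, hk, hαk⟩ := (mem_posRoots_diff_iff b J).mp hα
  rw [eq_empty_iff_forall_notMem]
  refine ⟨fun h δ hδ ↦ ?_, ?_⟩
  · by_contra! hneg
    refine h _ ⟨(mem_posRoots_diff_iff b J).mpr ⟨k, hk, ?_⟩, mem_image_of_mem _ hδ⟩
    rw [coeff_reflectionPerm]
    simpa [((mem_posRootsP_iff b J).mp hδ).2 k hk] using mul_neg_of_neg_of_pos hneg hαk
  · rintro h _ ⟨hγ, δ, hδ, rfl⟩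
    obtain ⟨l, hl, hγl⟩ := (mem_posRoots_diff_iff b J).mp hγ
    rw [coeff_reflectionPerm] at hγl
    simp only [Pi.sub_apply, ((mem_posRootsP_iff b J).mp hδ).2 l hl, Pi.smul_apply,
      smul_eq_mul] at hγl
    have := mul_nonneg (h δ hδ) (hpos l)
    omega

omit [IsDomain R] [Fintype ι] in
theorem hasUnitPairings_iff {α : ι} :
    (∀ γ ∈ inversions b (weylGroup.ofIdx P α) \ (posRootsP b J ∪ {α}), P.pairing γ α = 1) ↔
      HasUnitPairings b J α := by
  have h (γ : ι) : P.pairing γ α = 1 ↔ P.pairingIn ℤ γ α = 1 := by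
    rw [← P.algebraMap_pairingIn ℤ]
    simp
  simp only [h]
  refine ⟨fun h γ hγ hne hneg ↦ h γ ⟨⟨hγ.1, hneg⟩, ?_⟩, fun h γ hγ ↦ h γ ⟨hγ.1.1, ?_⟩ ?_ hγ.1.2⟩
  · rintro (h | h)
    exacts [hγ.2 h, hne h]
  · exact fun h ↦ hγ.2 (.inl h)
  · exact fun h ↦ hγ.2 (.inr h)

omit [IsDomain R] [Fintype ι] [P.IsCrystallographic] in
theorem isCosmall_iff {α : ι} (hα : α ∈ posRoots b \ posRootsP b J) :
    IsCosmall b J α ↔ ∀ β ∈ posRoots b \ posRootsP b J,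
      (∀ k ∉ J, cocoeff b β k ≤ cocoeff b α k) → coeff b α ≤ coeff b β → β = α := by
  simp only [IsCosmall, IsMaximalRoot, rootsBelow, mem_ofPred_eq, degreeLE_corootClass_iff,
    rootLE_iff_coeff_le]
  exact ⟨fun h β h₁ h₂ ↦ h.2 β ⟨h₁, h₂⟩, fun h ↦ ⟨⟨hα, fun _ _ ↦ le_rfl⟩, fun β h' ↦ h β h'.1 h'.2⟩⟩

omit [IsDomain R] [Fintype ι] [P.IsCrystallographic] in
theorem mem_posRoots_diff_of_le {α β : ι} (hα : α ∈ posRoots b \ posRootsP b J)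
    (h : coeff b α ≤ coeff b β) : β ∈ posRoots b \ posRootsP b J := by
  obtain ⟨k, hk, hαk⟩ := (mem_posRoots_diff_iff b J).mp hα
  exact (mem_posRoots_diff_iff b J).mpr ⟨k, hk, hαk.trans_le (h k)⟩

-- If `(δ, α^∨) < 0` with `δ ∈ R⁺_P`, then `s_δ α` is strictly above `α` and its coroot has the same
-- class in `H₂(X)`.
omit [IsDomain R] in
theorem IsCosmall.isDominantP {α : ι} (hα : α ∈ posRoots b \ posRootsP b J)
    (h : IsCosmall b J α) : IsDominantP b J α := by
  rw [isCosmall_iff hα] at h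
  intro δ hδ
  by_contra! hneg
  have hδ' := (mem_posRootsP_iff b J).mp hδ
  have hδ₀ := (isPos_iff_coeff b).mp hδ'.1
  have hneg' : P.pairingIn ℤ α δ < 0 := (P.pairingIn_lt_zero_iff ℤ).mp hneg
  have hc : coeff b (P.reflectionPerm δ α) = coeff b α + (-P.pairingIn ℤ α δ) • coeff b δ := by
    rw [coeff_reflectionPerm, sub_eq_add_neg, neg_smul]
  have hle : coeff b α ≤ coeff b (P.reflectionPerm δ α) := by
    rw [hc]
    exact le_add_of_nonneg_right (smul_nonneg (by omega) hδ₀)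
  have heq := h _ (mem_posRoots_diff_of_le hα hle) (fun k hk ↦ ?_) hle
  · rw [heq, left_eq_add, smul_eq_zero] at hc
    exact hc.elim (by omega) (coeff_ne_zero b δ)
  · rw [cocoeff_reflectionPerm]
    simp [cocoeff_eq_zero (hδ'.2 k hk)]

variable [P.IsReduced]

omit [IsDomain R] [P.IsReduced] [Fintype ι] in
theorem pairingIn_pos_of_not_isPos {α γ : ι} (hα : b.IsPos α) (hγ : b.IsPos γ)
    (h : ¬ b.IsPos (P.reflectionPerm α γ)) : 0 < P.pairingIn ℤ γ α := by
  by_contra! h'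
  refine h ((isPos_iff_coeff b).mpr ?_)
  rw [coeff_reflectionPerm, sub_eq_add_neg, ← neg_smul]
  exact add_nonneg ((isPos_iff_coeff b).mp hγ)
    (smul_nonneg (by omega) ((isPos_iff_coeff b).mp hα))

/-- Suppose an inverted `γ ≠ α` pairs to at least 2. Then `(α, γ^∨) = 1` and `γ' = -s_α γ` satisfies
`γ^∨ + γ'^∨ = α^∨`, so both degrees are at most that of `α`. Since `α - γ = s_γ α` is a root, its
sign puts `γ'` or `γ` above `α`. -/
theorem IsCosmall.hasUnitPairings {α : ι} (hα : α ∈ posRoots b \ posRootsP b J)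
    (h : IsCosmall b J α) : HasUnitPairings b J α := by
  rw [isCosmall_iff hα] at h
  intro γ hγ hne hneg
  by_contra hne1
  have hαpos : b.IsPos α := hα.1
  have hγpos : b.IsPos γ := hγ.1
  have hp := pairingIn_pos_of_not_isPos hαpos hγpos hneg
  have hL₀ := sqLength_pos P α
  have hαγ : P.pairingIn ℤ α γ = 1 := by
    rcases pairingIn_sqLength_cases P γ α with h | h | h | h | h | h | h | h | h | h | h | h | h
    any_goals omega
    exact absurd h.2.2 hne
  have hLne : sqLength P γ ≠ sqLength P α := by
    rcases pairingIn_sqLength_cases P γ α with h | h | h | h | h | h | h | h | h | h | h | h | h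
    all_goals omega
  -- Reflecting a root in itself gives the index of its negative.
  set γ' := P.reflectionPerm (P.reflectionPerm α γ) (P.reflectionPerm α γ) with hγ'
  have hγ'c : coeff b γ' = P.pairingIn ℤ γ α • coeff b α - coeff b γ := by
    rw [coeff_reflectionPerm_self, coeff_reflectionPerm, neg_sub]
  have hγ'co : cocoeff b γ' = cocoeff b α - cocoeff b γ := by
    rw [cocoeff_reflectionPerm_self, cocoeff_reflectionPerm, hαγ, neg_sub, one_smul]
  have hγ'₀ : 0 ≤ coeff b γ' := by
    rw [coeff_reflectionPerm_self]
    exact neg_nonneg.mpr ((not_isPos_iff_coeff b).mp hneg)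
  have hle : cocoeff b γ ≤ cocoeff b α := fun k ↦ by
    have := cocoeff_nonneg (hγ'₀ k)
    simpa [hγ'co] using this
  have hε : coeff b (P.reflectionPerm γ α) = coeff b α - coeff b γ := by
    rw [coeff_reflectionPerm, hαγ, one_smul]
  rcases coeff_nonneg_or_nonpos b (P.reflectionPerm γ α) with hs | hs
  · rw [hε] at hs
    have hle' : coeff b α ≤ coeff b γ' := by
      have h₂ : 0 ≤ (P.pairingIn ℤ γ α - 2) • coeff b α :=
        smul_nonneg (by omega) ((isPos_iff_coeff b).mp hαpos)
      have h₃ : coeff b γ' - coeff b α =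
          (coeff b α - coeff b γ) + (P.pairingIn ℤ γ α - 2) • coeff b α := by
        rw [hγ'c]
        module
      rw [← sub_nonneg, h₃]
      exact add_nonneg hs h₂
    have heq := h γ' (mem_posRoots_diff_of_le hα hle') (fun k _ ↦ ?_) hle'
    · refine hLne ?_
      rw [← heq, hγ']
      simp
    · rw [hγ'co]
      exact sub_le_self _ (cocoeff_nonneg ((isPos_iff_coeff b).mp hγpos k))
  · rw [hε] at hs
    exact hne (h γ hγ (fun k _ ↦ hle k) (sub_nonpos.mp hs))

/-- Put `m = (β, α^∨) ≥ 2`. The coordinate bound makes `s_α β = β - mα` non-positive outside `J`;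
were it positive, it would lie in `R⁺_P` and pair to `-m`, against dominance. So `s_α` inverts both
`β` and `mα - β`, which pair to `m`, and one of them lies outside `R⁺_P`. -/
theorem false_of_acute_long_root {α β : ι} (hα : α ∈ posRoots b \ posRootsP b J)
    (hdom : IsDominantP b J α) (hunit : HasUnitPairings b J α)
    (hL : sqLength P α < sqLength P β) (hβ : b.IsPos β) (hp : 0 < P.pairingIn ℤ β α)
    (hle : ∀ k ∉ J, coeff b β k ≤ P.pairingIn ℤ β α * coeff b α k) : False := by
  obtain ⟨-, -, h2⟩ := pairingIn_of_sqLength_lt hL hp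
  set γ := P.reflectionPerm α β with hγ
  set γ' := P.reflectionPerm γ γ with hγ'
  have hγc : coeff b γ = coeff b β - P.pairingIn ℤ β α • coeff b α := coeff_reflectionPerm b β α
  have hγ'c : coeff b γ' = -coeff b γ := coeff_reflectionPerm_self γ
  have hγα : P.pairingIn ℤ γ α = -P.pairingIn ℤ β α := by
    rw [hγ, pairingIn_reflectionPerm_left]
    simp
    ring
  have hγneg : ¬ b.IsPos γ := by
    intro hpos
    have hγP : γ ∈ posRootsP b J := (mem_posRootsP_iff b J).mpr ⟨hpos, fun k hk ↦ by
      have h₁ := hle k hk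
      have h₂ := (isPos_iff_coeff b).mp hpos k
      rw [hγc] at h₂ ⊢
      simp only [Pi.sub_apply, Pi.smul_apply, smul_eq_mul, Pi.zero_apply] at h₂ ⊢
      omega⟩
    have := hdom γ hγP
    omega
  by_cases hβS : β ∈ posRoots b \ posRootsP b J
  · have := hunit β hβS (by rintro rfl; omega) hγneg
    omega
  · obtain ⟨k, hk, hαk⟩ := (mem_posRoots_diff_iff b J).mp hα
    have hβk : coeff b β k = 0 := by
      by_contra h
      exact hβS ((mem_posRoots_diff_iff b J).mpr ⟨k, hk,
        lt_of_le_of_ne ((isPos_iff_coeff b).mp hβ k) (Ne.symm h)⟩)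
    have hγ'S : γ' ∈ posRoots b \ posRootsP b J :=
      (mem_posRoots_diff_iff b J).mpr ⟨k, hk, by
        rw [hγ'c, hγc]
        simpa [hβk] using mul_pos hp hαk⟩
    have hLγ' : sqLength P γ' = sqLength P β := by simp [hγ', hγ]
    have h := hunit γ' hγ'S (by intro h; rw [h] at hLγ'; omega) ?_
    · rw [hγ', pairingIn_reflectionPerm_self_left, hγα] at h
      omega
    · have : coeff b (P.reflectionPerm α γ') = -coeff b β := by
        rw [coeff_reflectionPerm, hγ'c, hγ', pairingIn_reflectionPerm_self_left, hγα, hγc]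
        module
      rw [not_isPos_iff_coeff, this]
      exact neg_nonpos.mpr ((isPos_iff_coeff b).mp hβ)

theorem isCosmall_of_isDominantP_of_hasUnitPairings {α : ι}
    (hα : α ∈ posRoots b \ posRootsP b J) (hdom : IsDominantP b J α)
    (hunit : HasUnitPairings b J α) : IsCosmall b J α := by
  rw [isCosmall_iff hα]
  intro β hβ hco hαβ
  have hα₀ := (isPos_iff_coeff b).mp hα.1
  -- The inequality of degrees, translated from coroot to root coordinates.
  have hmul : ∀ k ∉ J, coeff b β k * sqLength P α ≤ coeff b α k * sqLength P β := by
    intro k hk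
    refine le_of_mul_le_mul_right ?_ (sqLength_pos P k)
    have h₁ := cocoeff_mul_sqLength b β k
    have h₂ := cocoeff_mul_sqLength b α k
    calc coeff b β k * sqLength P α * sqLength P k
        = cocoeff b β k * (sqLength P β * sqLength P α) := by rw [← mul_assoc, h₁]; ring
      _ ≤ cocoeff b α k * (sqLength P β * sqLength P α) := mul_le_mul_of_nonneg_right (hco k hk)
          (mul_pos (sqLength_pos P β) (sqLength_pos P α)).le
      _ = coeff b α k * sqLength P β * sqLength P k := by
          rw [mul_comm (sqLength P β), ← mul_assoc, h₂]; ring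
  obtain ⟨k₀, hk₀, hαk₀⟩ := (mem_posRoots_diff_iff b J).mp hα
  have hLle : sqLength P α ≤ sqLength P β := by
    refine le_of_mul_le_mul_left ?_ hαk₀
    exact (mul_le_mul_of_nonneg_right (hαβ k₀) (sqLength_pos P α).le).trans (hmul k₀ hk₀)
  rcases hLle.eq_or_lt with hL | hL
  · have hsimple : ∀ k ∈ J, 0 ≤ P.pairingIn ℤ k α := fun k hk ↦ by
      refine hdom k ((mem_posRootsP_iff b J).mpr ⟨b.isPos_of_mem_support k.2, fun l hl ↦ ?_⟩)
      exact coeff_simple_of_ne b (by rintro rfl; exact hl hk)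
    have h₁ : 0 ≤ ∑ k, (coeff b β k - coeff b α k) * P.pairingIn ℤ k α := by
      refine Finset.sum_nonneg fun k _ ↦ ?_
      by_cases hk : k ∈ J
      · exact mul_nonneg (sub_nonneg.mpr (hαβ k)) (hsimple k hk)
      · have h₂ := hmul k hk
        rw [← hL] at h₂
        have h₃ := le_antisymm (le_of_mul_le_mul_right h₂ (sqLength_pos P α)) (hαβ k)
        simp [h₃]
    simp only [sub_mul, Finset.sum_sub_distrib, ← pairingIn_eq_sum b, pairingIn_same] at h₁
    have := sqLength_pos P α
    rcases pairingIn_sqLength_cases P β α with h | h | h | h | h | h | h | h | h | h | h | h | h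
    any_goals omega
    exact h.2.2
  · exfalso
    have hratio {c : ℤ} (hc : sqLength P β = c * sqLength P α) (k : b.support) (hk : k ∉ J) :
        coeff b β k ≤ c * coeff b α k := by
      refine le_of_mul_le_mul_right ?_ (sqLength_pos P α)
      have := hmul k hk
      rw [hc] at this
      linarith
    rcases exists_long_root_pairingIn_pos hα.1 hαβ hL with
      ⟨β', h₁, h₂, h₃, -, h₅⟩ | ⟨k, β', h₁, h₂, h₃, h₄, h₅, h₆⟩ | ⟨k, l, h₁, h₂, h₃, h₄⟩
    · have hL' : sqLength P α < sqLength P β' := h₂ ▸ hL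
      exact false_of_acute_long_root hα hdom hunit hL' h₁ h₅ fun k hk ↦ (h₃ k).trans
        (hratio (h₂ ▸ (pairingIn_of_sqLength_lt hL' h₅).2.1) k hk)
    · set γ := P.reflectionPerm k α with hγ
      have hγc : coeff b γ = coeff b α + coeff b k := by
        rw [coeff_reflectionPerm, h₁]
        module
      have hβ'k : P.pairingIn ℤ β' k = 3 := by
        rw [pairingIn_eq_of_coeff_eq b h₅, h₁, pairingIn_same]
        norm_num
      have hβ'α : P.pairingIn ℤ β' α = 0 := by
        rw [pairingIn_eq_of_coeff_eq b h₅, h₂, pairingIn_same]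
        norm_num
      have hβ'γ : P.pairingIn ℤ β' γ = 3 := by
        rw [hγ, pairingIn_reflectionPerm, pairingIn_reflectionPerm_left, hβ'k, hβ'α, h₂]
        norm_num
      have hγα : P.pairingIn ℤ γ α = 1 := by
        rw [hγ, pairingIn_reflectionPerm_left, h₁, h₂, pairingIn_same]
        norm_num
      -- Here `β' = α + 2k` is orthogonal to `α`. The other long root `2α + k = -s_γ β'` pairs to 3
      -- with `α^∨`, and `α + 2k ≤ β` with the bound `3α` on `β` outside `J` yields the bound it
      -- needs.
      set δ := P.reflectionPerm γ β' with hδ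
      have hβ''c : coeff b (P.reflectionPerm δ δ) = (2 : ℤ) • coeff b α + coeff b k := by
        rw [coeff_reflectionPerm_self, hδ, coeff_reflectionPerm, hβ'γ, h₅, hγc]
        module
      have hβ''α : P.pairingIn ℤ (P.reflectionPerm δ δ) α = 3 := by
        rw [pairingIn_reflectionPerm_self_left, hδ, pairingIn_reflectionPerm_left, hβ'α, hβ'γ, hγα]
        norm_num
      refine false_of_acute_long_root (β := P.reflectionPerm δ δ) hα hdom hunit ?_ ?_
        (by omega) fun l hl ↦ ?_
      · have := sqLength_pos P α
        simp only [hδ, sqLength_reflectionPerm]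
        omega
      · rw [isPos_iff_coeff, hβ''c]
        exact add_nonneg (smul_nonneg (by norm_num) hα₀) (coeff_simple_nonneg b k)
      · have h₇ := hratio h₃ l hl
        have h₈ := h₆ l
        rw [h₅] at h₈
        rw [hβ''c, hβ''α]
        simp only [Pi.add_apply, Pi.smul_apply, smul_eq_mul] at h₈ ⊢
        omega
    -- Dominance excludes `l ∈ J`, and then `3α + l ≤ β` contradicts the bound `3α` at the
    -- coordinate `l`.
    · have hl : l ∉ J := fun hl ↦ by
        have := hdom l ((mem_posRootsP_iff b J).mpr ⟨b.isPos_of_mem_support l.2, fun m hm ↦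
          coeff_simple_of_ne b (by rintro rfl; exact hm hl)⟩)
        omega
      have h₅ := hratio h₃ l hl
      have h₆ := h₄ l
      rw [h₁] at h₅
      simp only [Pi.add_apply, Pi.smul_apply, smul_eq_mul, coeff_simple_self] at h₆
      omega

/-- A root is `P`-cosmall if and only if it is dominant for `P` and the roots that its reflection
inverts pair to `1` with its coroot. -/
theorem isCosmall_iff_isDominantP_and_hasUnitPairings {α : ι}
    (hα : α ∈ posRoots b \ posRootsP b J) :
    IsCosmall b J α ↔ IsDominantP b J α ∧ HasUnitPairings b J α :=
  ⟨fun h ↦ ⟨h.isDominantP hα, h.hasUnitPairings hα⟩,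
    fun h ↦ isCosmall_of_isDominantP_of_hasUnitPairings hα h.1 h.2⟩

end Cosmall

/-! ### The degree as a count of inversions plus two defects. -/

section Counting

variable {ι R M N : Type*} [CommRing R] [CharZero R] [IsDomain R] [AddCommGroup M] [Module R M]
  [AddCommGroup N] [Module R N] {P : RootPairing ι R M N} {b : P.Base} {J : Set b.support}
  [Fintype ι] [P.IsCrystallographic]

open scoped Classical in
/-- The pairing of the sum of the roots of `R⁺ \ R⁺_P` with the coroot of `α`. -/
def degree (b : P.Base) (J : Set b.support) (α : ι) : ℤ :=
  ∑ γ ∈ Finset.univ.filter (· ∈ posRoots b \ posRootsP b J), P.pairingIn ℤ γ α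

variable [P.IsReduced]

open scoped Classical in
theorem cosetLength_reflection (α : ι) :
    cosetLength b J (QuotientGroup.mk (weylGroup.ofIdx P α)) =
      ((Finset.univ.filter (· ∈ posRoots b \ posRootsP b J)).filter
        fun γ ↦ ¬ b.IsPos (P.reflectionPerm α γ)).card := by
  change (inversions b (weylGroup.ofIdx P α) \ posRootsP b J).ncard = _
  rw [← Set.ncard_coe_finset]
  congr 1
  ext γ
  simp only [Finset.coe_filter, Finset.mem_filter, Finset.mem_univ, true_and, mem_ofPred_eq]
  exact ⟨fun h ↦ ⟨⟨h.1.1, h.2⟩, h.1.2⟩, fun h ↦ ⟨⟨h.1.1, h.2⟩, h.1.2⟩⟩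

open scoped Classical in
omit [IsDomain R] [P.IsReduced] in
theorem degree_eq {α : ι} (hα : α ∈ posRoots b \ posRootsP b J) :
    degree b J α = 1 + ((Finset.univ.filter (· ∈ posRoots b \ posRootsP b J)).filter
        fun γ ↦ ¬ b.IsPos (P.reflectionPerm α γ)).card +
      ∑ γ ∈ ((Finset.univ.filter (· ∈ posRoots b \ posRootsP b J)).filter
        fun γ ↦ ¬ b.IsPos (P.reflectionPerm α γ)).erase α, (P.pairingIn ℤ γ α - 1) +
      ∑ γ ∈ (Finset.univ.filter (· ∈ posRoots b \ posRootsP b J)).filter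
        fun γ ↦ P.reflectionPerm α γ ∈ posRootsP b J, P.pairingIn ℤ γ α := by
  set S := Finset.univ.filter (· ∈ posRoots b \ posRootsP b J) with hS
  have memS (γ : ι) : γ ∈ S ↔ γ ∈ posRoots b \ posRootsP b J := by simp [hS]
  have hαα : coeff b (P.reflectionPerm α α) ≤ 0 := by
    rw [coeff_reflectionPerm_self]
    exact neg_nonpos.mpr ((isPos_iff_coeff b).mp hα.1)
  have hαA : α ∈ S.filter fun γ ↦ ¬ b.IsPos (P.reflectionPerm α γ) :=
    Finset.mem_filter.mpr ⟨(memS α).mpr hα, (not_isPos_iff_coeff b).mpr hαα⟩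
  have hA : ∑ γ ∈ S.filter fun γ ↦ ¬ b.IsPos (P.reflectionPerm α γ), P.pairingIn ℤ γ α =
      1 + (S.filter fun γ ↦ ¬ b.IsPos (P.reflectionPerm α γ)).card +
      ∑ γ ∈ (S.filter fun γ ↦ ¬ b.IsPos (P.reflectionPerm α γ)).erase α,
        (P.pairingIn ℤ γ α - 1) := by
    rw [← Finset.add_sum_erase _ _ hαA, Finset.sum_sub_distrib, pairingIn_same,
      Finset.sum_const, Finset.card_erase_of_mem hαA, nsmul_one,
      Nat.cast_sub (Finset.card_pos.mpr ⟨α, hαA⟩)]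
    push_cast
    ring
  -- These are the roots with `s_α γ ∈ S`. The involution `s_α` negates the pairing, and its fixed
  -- points pair to zero.
  have hD : ∑ γ ∈ (S.filter fun γ ↦ ¬ ¬ b.IsPos (P.reflectionPerm α γ)).filter
      (fun γ ↦ ¬ P.reflectionPerm α γ ∈ posRootsP b J), P.pairingIn ℤ γ α = 0 := by
    refine Finset.sum_involution (fun γ _ ↦ P.reflectionPerm α γ) (fun γ _ ↦ ?_)
      (fun γ _ h h' ↦ h ?_) (fun γ hγ ↦ ?_) (fun γ _ ↦ by simp)
    · rw [pairingIn_reflectionPerm_left, pairingIn_same]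
      ring
    · have := pairingIn_reflectionPerm_left (P := P) γ α α
      rw [h', pairingIn_same] at this
      omega
    · simp only [Finset.mem_filter, memS, not_not] at hγ ⊢
      refine ⟨⟨⟨hγ.1.2, hγ.2⟩, ?_⟩, ?_⟩
      · simpa using show b.IsPos γ from hγ.1.1.1
      · simpa using hγ.1.1.2
  have hB : (S.filter fun γ ↦ ¬ ¬ b.IsPos (P.reflectionPerm α γ)).filter
      (fun γ ↦ P.reflectionPerm α γ ∈ posRootsP b J) =
      S.filter fun γ ↦ P.reflectionPerm α γ ∈ posRootsP b J := by
    ext γ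
    simp only [Finset.mem_filter, not_not]
    exact ⟨fun h ↦ ⟨h.1.1, h.2⟩, fun h ↦ ⟨⟨h.1, h.2.1⟩, h.2⟩⟩
  rw [degree, ← hS, ← Finset.sum_filter_add_sum_filter_not S
    (fun γ ↦ ¬ b.IsPos (P.reflectionPerm α γ)), hA, ← Finset.sum_filter_add_sum_filter_not
    (S.filter fun γ ↦ ¬ ¬ b.IsPos (P.reflectionPerm α γ))
    (fun γ ↦ P.reflectionPerm α γ ∈ posRootsP b J), hD, hB, add_zero]

theorem cosetLength_reflection_le {α : ι} (hα : α ∈ posRoots b \ posRootsP b J) :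
    (cosetLength b J (QuotientGroup.mk (weylGroup.ofIdx P α)) : ℤ) ≤ degree b J α - 1 ∧
    ((cosetLength b J (QuotientGroup.mk (weylGroup.ofIdx P α)) : ℤ) = degree b J α - 1 ↔
      (posRoots b \ posRootsP b J) ∩ (P.reflectionPerm α '' posRootsP b J) = ∅ ∧
        HasUnitPairings b J α) := by
  classical
  have hdeg := degree_eq hα
  rw [← cosetLength_reflection] at hdeg
  have h₁ : ∀ γ ∈ ((Finset.univ.filter (· ∈ posRoots b \ posRootsP b J)).filter
      fun γ ↦ ¬ b.IsPos (P.reflectionPerm α γ)).erase α, 0 ≤ P.pairingIn ℤ γ α - 1 := by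
    intro γ hγ
    simp only [Finset.mem_erase, Finset.mem_filter, Finset.mem_univ, true_and] at hγ
    have := pairingIn_pos_of_not_isPos hα.1 hγ.2.1.1 hγ.2.2
    omega
  have h₂ : ∀ γ ∈ (Finset.univ.filter (· ∈ posRoots b \ posRootsP b J)).filter
      fun γ ↦ P.reflectionPerm α γ ∈ posRootsP b J, 0 < P.pairingIn ℤ γ α := by
    intro γ hγ
    simp only [Finset.mem_filter, Finset.mem_univ, true_and] at hγ
    -- At this `k ∉ J` the coordinate of `s_α γ` is zero, so `(γ, α^∨) α_k = γ_k > 0`.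
    obtain ⟨k, hk, hγk⟩ := (mem_posRoots_diff_iff b J).mp hγ.1
    have h := ((mem_posRootsP_iff b J).mp hγ.2).2 k hk
    rw [coeff_reflectionPerm] at h
    simp only [Pi.sub_apply, Pi.smul_apply, smul_eq_mul] at h
    have hα₀ : 0 ≤ coeff b α k := (isPos_iff_coeff b).mp hα.1 k
    refine pos_of_mul_pos_left ?_ hα₀
    omega
  have h₃ := Finset.sum_nonneg h₁
  have h₄ := Finset.sum_nonneg fun γ hγ ↦ (h₂ γ hγ).le
  refine ⟨by omega, ?_⟩
  trans (∑ γ ∈ ((Finset.univ.filter (· ∈ posRoots b \ posRootsP b J)).filter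
        fun γ ↦ ¬ b.IsPos (P.reflectionPerm α γ)).erase α, (P.pairingIn ℤ γ α - 1) = 0) ∧
      (∑ γ ∈ (Finset.univ.filter (· ∈ posRoots b \ posRootsP b J)).filter
        fun γ ↦ P.reflectionPerm α γ ∈ posRootsP b J, P.pairingIn ℤ γ α = 0)
  · constructor
    · intro h
      constructor <;> omega
    · rintro ⟨h, h'⟩
      omega
  rw [and_comm]
  refine and_congr ⟨fun h ↦ ?_, fun h ↦ ?_⟩ ?_
  · rw [eq_empty_iff_forall_notMem]
    rintro _ ⟨hγ, δ, hδ, rfl⟩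
    have hmem : P.reflectionPerm α δ ∈ (Finset.univ.filter (· ∈ posRoots b \ posRootsP b J)).filter
        fun γ ↦ P.reflectionPerm α γ ∈ posRootsP b J := by
      simp only [Finset.mem_filter, Finset.mem_univ, true_and]
      exact ⟨hγ, by simpa using hδ⟩
    exact (h₂ _ hmem).ne' ((Finset.sum_eq_zero_iff_of_nonneg fun γ hγ ↦ (h₂ γ hγ).le).mp h _ hmem)
  · refine Finset.sum_eq_zero fun γ hγ ↦ ?_
    simp only [Finset.mem_filter, Finset.mem_univ, true_and] at hγ
    exact ((eq_empty_iff_forall_notMem.mp h) γ ⟨hγ.1, _, hγ.2, by simp⟩).elim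
  · rw [Finset.sum_eq_zero_iff_of_nonneg h₁]
    simp only [Finset.mem_erase, Finset.mem_filter, Finset.mem_univ, true_and, sub_eq_zero]
    exact ⟨fun h γ hγ hne hneg ↦ h γ ⟨hne, hγ, hneg⟩, fun h γ hγ ↦ h γ hγ.2.1 hγ.1 hγ.2.2⟩

end Counting

open RootPairing.Base LieAlgebra LieAlgebra.IsKilling LieModule

/-! ### The weights of `L/p` and the first Chern class. -/

section Lie

variable {L : Type*} [LieRing L] [LieAlgebra ℂ L] [FiniteDimensional ℂ L] [IsKilling ℂ L]
  {H : LieSubalgebra ℂ L} [H.IsCartanSubalgebra]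

theorem rootSpace_le_of_mem_of_ne_zero {p : LieSubalgebra ℂ L} {α : Weight ℂ H L}
    (hα : α.IsNonZero) {x : L} (hx : x ∈ rootSpace H α) (hx₀ : x ≠ 0) (hxp : x ∈ p) :
    ∀ y ∈ rootSpace H α, y ∈ p := by
  intro y hy
  obtain ⟨k, hk⟩ := (finrank_eq_one_iff_of_nonzero' (⟨x, hx⟩ : rootSpace H α)
    (by simpa using hx₀)).mp (finrank_rootSpace_eq_one α hα) ⟨y, hy⟩
  have : k • x = y := congrArg Subtype.val hk
  exact this ▸ p.smul_mem k hxp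

/-- Take the `sl₂`-triple of `α` and a top vector of the `α`-chain through `β`. Lowering it to
weight `β` gives `y`; as `α + β` is a weight, `β` is not the top of the chain, so `e` does not kill
`y`. -/
theorem exists_lie_ne_zero (α β γ : Weight ℂ H L) (hα : α.IsNonZero)
    (h : (γ : H → ℂ) = α + β) :
    ∃ x ∈ rootSpace H α, ∃ y ∈ rootSpace H β, ⁅x, y⁆ ≠ 0 := by
  have hq : 1 ≤ chainTopCoeff α β := by
    have h₁ : rootSpace H ((1 : ℤ) • (α : H → ℂ) + β) ≠ ⊥ := by
      rw [one_smul, ← h]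
      exact γ.genWeightSpace_ne_bot
    exact_mod_cast ((rootSpace_zsmul_add_ne_bot_iff α β hα 1).mp h₁).1
  obtain ⟨x, hx, x_ne0⟩ := (chainTop α β).exists_ne_zero
  obtain ⟨h, e, f, isSl2, he, hf⟩ := exists_isSl2Triple_of_weight_isNonZero hα
  obtain rfl := isSl2.h_eq_coroot hα he hf
  have prim : isSl2.HasPrimitiveVectorWith x (chainLength α β : ℂ) :=
    have := lie_mem_genWeightSpace_of_mem_genWeightSpace he hx
    ⟨x_ne0, (chainLength_smul _ _ hx).symm, by rwa [genWeightSpace_add_chainTop _ _ hα] at this⟩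
  obtain ⟨n, hn⟩ := Nat.exists_eq_add_of_le' hq
  refine ⟨e, he, (toEnd ℂ L L f ^ (n + 1)) x, ?_, ?_⟩
  · have := toEnd_pow_apply_mem hf hx (n + 1)
    convert this using 2
    rw [coe_chainTop', hn]
    simp
  · rw [prim.lie_e_pow_succ_toEnd_f]
    have hlen := chainTopCoeff_le_chainLength α β
    refine smul_ne_zero (mul_ne_zero (by exact_mod_cast n.succ_ne_zero) ?_)
      (prim.pow_toEnd_f_ne_zero_of_eq_nat rfl (by omega))
    rw [sub_ne_zero]
    exact_mod_cast (show chainLength α β ≠ n by omega)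

/-- The root space of `i` is contained in the subalgebra `p`. -/
def ContainsRootSpace (p : LieSubalgebra ℂ L) (i : H.root) : Prop :=
  ∀ x ∈ rootSpace H (i : Weight ℂ H L), x ∈ p

theorem ContainsRootSpace.add {p : LieSubalgebra ℂ L} {i j k : H.root}
    (hi : ContainsRootSpace p i) (hj : ContainsRootSpace p j)
    (h : (rootSystem H).root k = (rootSystem H).root i + (rootSystem H).root j) :
    ContainsRootSpace p k := by
  have hk : ((k : Weight ℂ H L) : H → ℂ) = (i : Weight ℂ H L) + (j : Weight ℂ H L) := by
    ext x
    simpa using LinearMap.congr_fun h x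
  obtain ⟨x, hx, y, hy, hxy⟩ := exists_lie_ne_zero (i : Weight ℂ H L) j k (LieSubalgebra.isNonZero_coe_root i) hk
  refine rootSpace_le_of_mem_of_ne_zero (LieSubalgebra.isNonZero_coe_root k) ?_ hxy (p.lie_mem (hi x hx) (hj y hy))
  rw [hk]
  exact lie_mem_genWeightSpace_of_mem_genWeightSpace hx hy

theorem containsRootSpace_of_isPos {b : (rootSystem H).Base} {p : LieSubalgebra ℂ L}
    (hp : borel b ≤ p) {i : H.root} (hi : b.IsPos i) : ContainsRootSpace p i := fun _ hx ↦
  hp (LieSubalgebra.subset_lieSpan (.inr (mem_iUnion₂.mpr ⟨i, hi, hx⟩)))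

theorem root_reflectionPerm_self (i : H.root) :
    (rootSystem H).root ((rootSystem H).reflectionPerm i i) = -(rootSystem H).root i := by
  rw [root_reflectionPerm, reflection_apply_self]

theorem coe_reflectionPerm_self (i : H.root) :
    (((rootSystem H).reflectionPerm i i : H.root) : Weight ℂ H L) = -(i : Weight ℂ H L) := by
  ext x
  exact LinearMap.congr_fun (root_reflectionPerm_self i) x

theorem mem_simpleRootsP_iff {b : (rootSystem H).Base} {p : LieSubalgebra ℂ L} {j : b.support} :
    j ∈ simpleRootsP b p ↔ ContainsRootSpace p ((rootSystem H).reflectionPerm j j) := by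
  rw [ContainsRootSpace, coe_reflectionPerm_self, Weight.coe_neg]
  rfl

/-- Build the root by adding simple roots. For `k = i + j`, bracketing the `-k` space with the
positive root spaces in `p` gives those of `-i` and `-j`; conversely these two bracket to that of
`-k`. -/
theorem containsRootSpace_neg_iff {b : (rootSystem H).Base} {p : LieSubalgebra ℂ L}
    (hp : borel b ≤ p) {i : H.root} (hi : b.IsPos i) :
    ContainsRootSpace p ((rootSystem H).reflectionPerm i i) ↔
      i ∈ posRootsP b (simpleRootsP b p) := by
  suffices b.IsPos i → (ContainsRootSpace p ((rootSystem H).reflectionPerm i i) ↔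
      ∀ k ∉ simpleRootsP b p, coeff b i k = 0) by
    rw [mem_posRootsP_iff, this hi]
    exact (and_iff_right hi).symm
  refine hi.induction_on_add (p := fun i ↦ b.IsPos i →
    (ContainsRootSpace p ((rootSystem H).reflectionPerm i i) ↔
      ∀ k ∉ simpleRootsP b p, coeff b i k = 0)) (fun j hj _ ↦ ?_) fun i j k hk ih hj hkpos ↦ ?_
  · lift j to b.support using hj
    rw [← mem_simpleRootsP_iff]
    refine ⟨fun h k hk ↦ coeff_simple_of_ne b (by rintro rfl; exact hk h), fun h ↦ ?_⟩
    by_contra hj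
    simpa using h j hj
  · lift j to b.support using hj
    have hipos : b.IsPos i := hkpos.sub j.2 (by rw [hk, add_sub_cancel_right])
    have hjpos := b.isPos_of_mem_support j.2
    have hkc : coeff b k = coeff b i + coeff b j := by
      simpa using coeff_eq_add_smul b (z := 1) (by simpa using hk)
    have hi₀ := (isPos_iff_coeff b).mp hipos
    constructor
    · intro h l hl
      have h₁ := (ih hipos).mp (h.add (containsRootSpace_of_isPos hp hjpos)
        (by rw [root_reflectionPerm_self, root_reflectionPerm_self, hk]; abel)) l hl
      have h₂ := mem_simpleRootsP_iff.mpr (h.add (containsRootSpace_of_isPos hp hipos)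
        (k := (rootSystem H).reflectionPerm j j)
        (by rw [root_reflectionPerm_self, root_reflectionPerm_self, hk]; abel))
      rw [hkc, Pi.add_apply, h₁, coeff_simple_of_ne b (by rintro rfl; exact hl h₂), add_zero]
    · intro h
      have hz (l) (hl : l ∉ simpleRootsP b p) : coeff b i l = 0 ∧ coeff b j l = 0 := by
        have h₁ := h l hl
        have h₂ := hi₀ l
        have h₃ := coeff_simple_nonneg b j l
        simp only [hkc, Pi.add_apply, Pi.zero_apply] at h₁ h₂ h₃
        omega
      refine ((ih hipos).mpr fun l hl ↦ (hz l hl).1).add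
        ((mem_simpleRootsP_iff (j := j)).mp ?_)
        (by rw [root_reflectionPerm_self, root_reflectionPerm_self, root_reflectionPerm_self, hk,
          neg_add])
      by_contra hj
      simpa using (hz j hj).2

/-- The roots of `R⁺ \ R⁺_P`. -/
abbrev RootsX (b : (rootSystem H).Base) (p : LieSubalgebra ℂ L) : Type _ :=
  {i : H.root // i ∈ posRoots b \ posRootsP b (simpleRootsP b p)}

theorem exists_negRootVector {b : (rootSystem H).Base} {p : LieSubalgebra ℂ L} (hp : borel b ≤ p)
    (i : RootsX b p) :
    ∃ x ∈ rootSpace H (((rootSystem H).reflectionPerm i i : H.root) : Weight ℂ H L), x ∉ p := by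
  by_contra! h
  exact i.2.2 ((containsRootSpace_neg_iff hp i.2.1).mp h)

/-- A root vector of weight `-γ` for each `γ ∈ R⁺ \ R⁺_P`. -/
def negRootVector {b : (rootSystem H).Base} {p : LieSubalgebra ℂ L} (hp : borel b ≤ p)
    (i : RootsX b p) : L := (exists_negRootVector hp i).choose

/-- The classes in `L / p` of the root vectors of the negatives of the roots in `R⁺ \ R⁺_P`. -/
def tangentVector {b : (rootSystem H).Base} {p : LieSubalgebra ℂ L} (hp : borel b ≤ p)
    (i : RootsX b p) : L ⧸ p.toLieSubmodule :=
  LieSubmodule.Quotient.mk (negRootVector hp i)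

variable {b : (rootSystem H).Base} {p : LieSubalgebra ℂ L} (hp : borel b ≤ p)

theorem lie_tangentVector (i : RootsX b p) (h : H) :
    ⁅LieSubalgebra.inclusion (cartan_le_of_borel_le hp) h, tangentVector hp i⁆ =
      (-(i : H.root).1 h) • tangentVector hp i := by
  have h₁ : ⁅(h : L), negRootVector hp i⁆ =
      (((rootSystem H).reflectionPerm i i : H.root) : Weight ℂ H L) h • negRootVector hp i :=
    lie_eq_smul_of_mem_rootSpace (exists_negRootVector hp i).choose_spec.1 h
  have h₂ : (((rootSystem H).reflectionPerm i i : H.root) : Weight ℂ H L) h =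
      -(i : H.root).1 h := by
    rw [coe_reflectionPerm_self]
    rfl
  rw [h₂] at h₁
  exact congrArg (Submodule.Quotient.mk (p := (p.toLieSubmodule : Submodule ℂ L))) h₁

theorem tangentVector_ne_zero (i : RootsX b p) : tangentVector hp i ≠ 0 := fun h ↦
  (exists_negRootVector hp i).choose_spec.2
    ((Submodule.Quotient.mk_eq_zero (p.toLieSubmodule : Submodule ℂ L)).mp h)

/-- Restricting the action of `p` on `L/p` to `H` makes these vectors non-zero weight vectors of
distinct weights. -/
theorem linearIndependent_tangentVector : LinearIndependent ℂ (tangentVector hp) := by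
  let _ : LieRingModule H (L ⧸ p.toLieSubmodule) :=
    LieRingModule.compLieHom _ (LieSubalgebra.inclusion (cartan_le_of_borel_le hp))
  have _ : LieModule ℂ H (L ⧸ p.toLieSubmodule) :=
    LieModule.compLieHom _ (LieSubalgebra.inclusion (cartan_le_of_borel_le hp))
  have hind := LieSubmodule.iSupIndep_toSubmodule.mpr
    (iSupIndep_genWeightSpace ℂ H (L ⧸ p.toLieSubmodule))
  have hinj : Function.Injective fun i : RootsX b p ↦ -((i : H.root).1 : H → ℂ) := by
    intro i j hij
    exact Subtype.ext (Subtype.ext (DFunLike.coe_injective (neg_injective hij)))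
  refine (hind.comp hinj).linearIndependent _ (fun i ↦ ?_) (tangentVector_ne_zero hp)
  refine weightSpace_le_genWeightSpace _ _ ((mem_weightSpace _ _).mpr fun h ↦ ?_)
  exact lie_tangentVector hp i h

theorem span_tangentVector : ⊤ ≤ Submodule.span ℂ (range (tangentVector hp)) := by
  set f : L →ₗ[ℂ] L ⧸ p.toLieSubmodule := (p.toLieSubmodule : Submodule ℂ L).mkQ with hf
  have hker {x : L} (hx : x ∈ p) : f x ∈ Submodule.span ℂ (range (tangentVector hp)) := by
    rw [show f x = 0 from (Submodule.Quotient.mk_eq_zero _).mpr hx]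
    exact zero_mem _
  have hle : (⊤ : Submodule ℂ L) ≤ (Submodule.span ℂ (range (tangentVector hp))).comap f := by
    rw [← LieSubmodule.iSup_toSubmodule_eq_top.mpr (iSup_genWeightSpace_eq_top' ℂ H L), iSup_le_iff]
    intro χ x hx
    rw [Submodule.mem_comap]
    by_cases hχ : χ.IsZero
    · refine hker (cartan_le_of_borel_le hp ?_)
      rw [← zeroRootSubalgebra_eq_of_is_cartan ℂ L H]
      change x ∈ rootSpace H 0
      rwa [← show (χ : H → ℂ) = 0 from hχ]
    obtain ⟨i, rfl⟩ : ∃ i : H.root, (i : Weight ℂ H L) = χ := ⟨⟨χ, by simpa using hχ⟩, rfl⟩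
    by_cases hi : ContainsRootSpace p i
    · exact hker (hi x hx)
    obtain ⟨j, rfl⟩ : ∃ j : H.root, (rootSystem H).reflectionPerm j j = i :=
      ⟨(rootSystem H).reflectionPerm i i, (rootSystem H).root.injective (by
        rw [root_reflectionPerm_self, root_reflectionPerm_self, neg_neg])⟩
    have hj : b.IsPos j := (IsPos.or_neg b j).resolve_right fun hneg ↦
      hi (containsRootSpace_of_isPos hp hneg)
    have hj' : j ∈ posRoots b \ posRootsP b (simpleRootsP b p) :=
      ⟨hj, fun h ↦ hi ((containsRootSpace_neg_iff hp hj).mpr h)⟩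
    obtain ⟨k, hk⟩ := (finrank_eq_one_iff_of_nonzero'
      (⟨negRootVector hp ⟨j, hj'⟩, (exists_negRootVector hp ⟨j, hj'⟩).choose_spec.1⟩ :
        rootSpace H (((rootSystem H).reflectionPerm j j : H.root) : Weight ℂ H L))
      fun h ↦ tangentVector_ne_zero hp ⟨j, hj'⟩
        ((congrArg f (congrArg Subtype.val h)).trans (map_zero f))).mp
      (finrank_rootSpace_eq_one _ (LieSubalgebra.isNonZero_coe_root _)) ⟨x, hx⟩
    have hkx : k • negRootVector hp ⟨j, hj'⟩ = x := congrArg Subtype.val hk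
    rw [← hkx, map_smul]
    exact Submodule.smul_mem _ _ (Submodule.subset_span ⟨⟨j, hj'⟩, rfl⟩)
  rw [← Submodule.range_mkQ (p.toLieSubmodule : Submodule ℂ L), LinearMap.range_eq_map]
  exact Submodule.map_le_iff_le_comap.mpr hle

-- In the basis of tangent vectors `H` acts diagonally by the weights `-γ`; the sign in `chernClass`
-- turns the trace into the sum of the `γ`.
open scoped Classical in
theorem chernClassTangent_apply (h : H) :
    chernClassTangent (cartan_le_of_borel_le hp) h = ∑ i : RootsX b p, (i : H.root).1 h := by
  let B := Module.Basis.mk (linearIndependent_tangentVector hp) (span_tangentVector hp)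
  have hB (i : RootsX b p) : B i = tangentVector hp i := Module.Basis.mk_apply _ _ i
  rw [chernClassTangent, chernClass, LinearMap.neg_apply, LinearMap.comp_apply,
    LinearMap.trace_eq_matrix_trace ℂ B, Matrix.trace, ← Finset.sum_neg_distrib]
  refine Finset.sum_congr rfl fun i _ ↦ ?_
  have h₁ : (toEnd ℂ p (L ⧸ p.toLieSubmodule)
      (LieSubalgebra.inclusion (cartan_le_of_borel_le hp) h)) (B i) =
      (-(i : H.root).1 h) • B i := by
    rw [hB]
    exact lie_tangentVector hp i h
  rw [Matrix.diag_apply, LinearMap.toMatrix_apply]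
  erw [h₁]
  simp

end Lie

end FlagVariety

end

open FlagVariety LieAlgebra.IsKilling

theorem mainTheorem3 {L : Type*} [LieRing L] [LieAlgebra ℂ L] [FiniteDimensional ℂ L]
    [LieAlgebra.IsSemisimple ℂ L] (H : LieSubalgebra ℂ L) [H.IsCartanSubalgebra]
    (b : (rootSystem H).Base) (p : LieSubalgebra ℂ L) (hp : borel b ≤ p)
    (α : H.root) (hα : α ∈ posRoots b \ posRootsP b (simpleRootsP b p)) :
    -- `n` is the pairing of `c₁(T_X)` with the coroot of `α`, which is an integer
    ∃ n : ℤ,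
      chernClassTangent (cartan_le_of_borel_le hp) ((rootSystem H).coroot α) = (n : ℂ) ∧
      (cosetLength b (simpleRootsP b p)
        (QuotientGroup.mk (RootPairing.weylGroup.ofIdx (rootSystem H) α)) : ℤ) ≤ n - 1 ∧
      List.TFAE [
        IsCosmall b (simpleRootsP b p) α,
        (cosetLength b (simpleRootsP b p)
          (QuotientGroup.mk (RootPairing.weylGroup.ofIdx (rootSystem H) α)) : ℤ) = n - 1,
        (posRoots b \ posRootsP b (simpleRootsP b p)) ∩
            ((rootSystem H).reflectionPerm α '' posRootsP b (simpleRootsP b p)) = ∅ ∧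
          ∀ γ ∈ inversions b (RootPairing.weylGroup.ofIdx (rootSystem H) α) \
              (posRootsP b (simpleRootsP b p) ∪ {α}),
            (rootSystem H).pairing γ α = 1] := by
  have hle := cosetLength_reflection_le hα
  refine ⟨degree b (simpleRootsP b p) α, ?_, hle.1, ?_⟩
  · classical
    rw [chernClassTangent_apply hp, degree, Int.cast_sum,
      Finset.sum_subtype (p := (· ∈ posRoots b \ posRootsP b (simpleRootsP b p))) _
        (fun _ ↦ by rw [Finset.mem_filter_univ])]
    refine Finset.sum_congr rfl fun i _ ↦ ?_
    exact ((rootSystem H).algebraMap_pairingIn ℤ i α).symm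
  · have hac := isCosmall_iff_isDominantP_and_hasUnitPairings hα
    rw [← isDominantP_iff hα] at hac
    rw [hle.2, hasUnitPairings_iff, hac]
    simp
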